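/- Let $\alpha_0\neq\beta_0$, $d^0\in(0,1)$ and $\mu(x)=\alpha_0 1(x\le d^0)+\beta_0 1(x>d^0)$. Let $0<\lambda<1$, $0<\gamma<1$, $K>0$, and let a budget of $n=n_1+n_2$ observations be split into two stages with $n_1/n\to\lambda$ (that is, $n_1=\lambda n$ and $n_2=(1-\lambda)n$ up to rounding). All errors below are i.i.d. copies of a mean-zero variable $\epsilon$, and are independent of the covariates. Stage 1. Draw $X_1,\dots,X_{n_1}$ i.i.d. uniform on $[0,1]$ and observe $Y_i=\mu(X_i)+\epsilon_i$. Let $(\hat\alpha_{n_1},\hat\beta_{n_1},\hat d_{n_1})$ be a minimizer of $$\frac1{n_1}\sum_{i=1}^{n_1}\big[(Y_i-\alpha)^2 1(X_i\le d)+(Y_i-\beta)^2 1(X_i>d)\big]$$ over $\alpha,\beta\in\mathbb R$, $d\in[0,1]$, whose third component is minimal. Stage 2. Given the first stage, draw $U_1,\dots,U_{n_2}$ i.i.d. uniform on $[\hat d_{n_1}-Kn_1^{-\gamma},\,\hat d_{n_1}+Kn_1^{-\gamma}]$ and observe $W_i=\mu(U_i)+\epsilon'_i$, with new errors $\epsilon'_i$.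 Let $\hat d_{n_2,l}$ and $\hat d_{n_2,u}$ be the smallest and the largest minimizers over $d\in[\hat d_{n_1}-Kn_1^{-\gamma},\,\hat d_{n_1}+Kn_1^{-\gamma}]$ of $$\frac1{n_2}\sum_{i=1}^{n_2}\big[(W_i-\hat\alpha_{n_1})^2 1(U_i\le d)+(W_i-\hat\beta_{n_1})^2 1(U_i>d)\big].$$ Here a minimizer, in the variable $d$, of a right-continuous function $f$ with left limits on an interval $I$ is a point $z\in I$ with $\min(f(z),f(z-))=\min_{w\in I}f(w)$. Theorem 1. Assume that $\epsilon$ has a finite moment generating function in a neighborhood of $0$. Then the random vectors $n^{1+\gamma}(\hat d_{n_2,l}-d^0,\ \hat d_{n_2,u}-d^0)$ are $O_p(1)$ as $n\to\infty$: for every $\delta>0$ there is an $A$ such that $\Pr\big(\big\|n^{1+\gamma}(\hat d_{n_2,l}-d^0,\hat d_{n_2,u}-d^0)\big\|>A\big)\le\delta$ for all $n$. -/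

import Mathlib

open MeasureTheory ProbabilityTheory Filter Topology Set

namespace ChangePoint

/-- The step regression function `α 1(x ≤ d) + β 1(x > d)`. -/
noncomputable def stump (α β d x : ℝ) : ℝ := if x ≤ d then α else β

/-- The least-squares criterion, the empirical mean of
`(y - α)² 1(x ≤ d) + (y - β)² 1(x > d)` over the sample `(x i, y i)`, `i < m`. -/
noncomputable def lsCriterion {m : ℕ} (x y : Fin m → ℝ) (α β d : ℝ) : ℝ :=
  (m : ℝ)⁻¹ * ∑ i, if x i ≤ d then (y i - α) ^ 2 else (y i - β) ^ 2

/-- `L` is the left limit at `z` of the function `f` on the interval `I`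
(the left endpoint of `I` has no left limit). -/
def IsLeftLimitOn (f : ℝ → ℝ) (I : Set ℝ) (z L : ℝ) : Prop :=
  (𝓝[I ∩ Iio z] z).NeBot ∧ Tendsto f (𝓝[I ∩ Iio z] z) (𝓝 L)

/-- Minimizers of a right-continuous function with left limits on an interval `I`: the points
`z ∈ I` at which `f z` or the left limit `f (z-)` is the minimum of `f` on `I`, that is,
`min (f z) (f (z-)) = min_{w ∈ I} f w`. -/
def IsMinimizerOn (f : ℝ → ℝ) (I : Set ℝ) (z : ℝ) : Prop :=
  z ∈ I ∧ ∃ v, IsLeast (f '' I) v ∧ (f z = v ∨ IsLeftLimitOn f I z v)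

/-- `(α, β, d)` minimizes the least-squares criterion over `ℝ × ℝ × [0, 1]`; in the variable `d`,
in which the criterion is right-continuous with left limits, minimizers are meant as above. -/
def IsLSMinimizer {m : ℕ} (x y : Fin m → ℝ) (α β d : ℝ) : Prop :=
  d ∈ Icc (0 : ℝ) 1 ∧
    ∃ v, IsLeast {r | ∃ a b, ∃ t ∈ Icc (0 : ℝ) 1, r = lsCriterion x y a b t} v ∧
      (lsCriterion x y α β d = v ∨ IsLeftLimitOn (lsCriterion x y α β) (Icc 0 1) d v)

/-- `(α, β, d)` is a least-squares minimizer whose third component is minimal. -/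
def IsFirstStageEstimate {m : ℕ} (x y : Fin m → ℝ) (α β d : ℝ) : Prop :=
  IsLSMinimizer x y α β d ∧ ∀ a b t, IsLSMinimizer x y a b t → d ≤ t

/-- A (measurable) least-squares estimator `(αhat, βhat, dhat)` of the three parameters of the
step function, for every sample size `m` and every sample. -/
structure IsFirstStageEstimator (αhat βhat dhat : ∀ m : ℕ, (Fin m → ℝ) → (Fin m → ℝ) → ℝ) :
    Prop where
  estimate : ∀ m x y, IsFirstStageEstimate x y (αhat m x y) (βhat m x y) (dhat m x y)
  measurable_α : ∀ m, Measurable fun p : (Fin m → ℝ) × (Fin m → ℝ) => αhat m p.1 p.2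
  measurable_β : ∀ m, Measurable fun p : (Fin m → ℝ) × (Fin m → ℝ) => βhat m p.1 p.2
  measurable_d : ∀ m, Measurable fun p : (Fin m → ℝ) × (Fin m → ℝ) => dhat m p.1 p.2

/-- The randomness of a two-stage experiment with `n₁ + n₂` observations and error law `ν`:
first-stage covariates `X` and errors `ε`, second-stage uniform variables `V` (from which the
second-stage covariates are obtained by rescaling) and errors `η`. All these variables
are mutually independent, `X i` and `V j` are uniform on `[0, 1]`, `ε i` and `η j` have law `ν`. -/
structure IsTwoStageExperiment {Ω : Type*} [MeasurableSpace Ω] (P : Measure Ω) (ν : Measure ℝ)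
    {n₁ n₂ : ℕ} (X ε : Fin n₁ → Ω → ℝ) (V η : Fin n₂ → Ω → ℝ) : Prop where
  indep : iIndepFun (Sum.elim (Sum.elim X ε) (Sum.elim V η)) P
  law_X : ∀ i, HasLaw (X i) (volume.restrict (Icc (0 : ℝ) 1)) P
  law_ε : ∀ i, HasLaw (ε i) ν P
  law_V : ∀ j, HasLaw (V j) (volume.restrict (Icc (0 : ℝ) 1)) P
  law_η : ∀ j, HasLaw (η j) ν P

/-- Responses `α₀ 1(x i ≤ d₀) + β₀ 1(x i > d₀) + e i` at the covariate values `x i`. -/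
noncomputable def responses {m : ℕ} (α₀ β₀ d₀ : ℝ) (x e : Fin m → ℝ) : Fin m → ℝ :=
  fun i => stump α₀ β₀ d₀ (x i) + e i

/-- The half-length `K n₁ ^ (-γ)` of the second-stage sampling interval. -/
noncomputable def halfLength (K γ : ℝ) (n₁ : ℕ) : ℝ := K * (n₁ : ℝ) ^ (-γ)

/-- The points `u j` of `[c - h, c + h]` at relative positions `v j ∈ [0, 1]`; if the `v j` are
i.i.d. uniform on `[0, 1]` and independent of `(c, h)`, then the `u j` are, given `(c, h)`,
i.i.d. uniform on `[c - h, c + h]`. -/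
def rescale {m : ℕ} (c h : ℝ) (v : Fin m → ℝ) : Fin m → ℝ :=
  fun j => (c - h) + 2 * h * v j

/-- The set of second-stage change-point estimates: with the first-stage estimates `α`, `β` plugged
in, the minimizers over `d ∈ [c - h, c + h]` of the least-squares criterion of the sample `(u, w)`. -/
def secondStageMinimizers {m : ℕ} (u w : Fin m → ℝ) (α β c h : ℝ) : Set ℝ :=
  {d | IsMinimizerOn (lsCriterion u w α β) (Icc (c - h) (c + h)) d}

/-- The sequence of random vectors `Z n` is `O_p(1)` (bounded in probability). -/
def IsBoundedInProbability {Ω E : Type*} [MeasurableSpace Ω] [NormedAddCommGroup E]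
    (P : Measure Ω) (Z : ℕ → Ω → E) : Prop :=
  ∀ δ : ℝ, 0 < δ → ∃ A : ℝ, ∀ n, P {ω | A < ‖Z n ω‖} ≤ ENNReal.ofReal δ

end ChangePoint

namespace ChangePoint

/-! ### Minimizers of the piecewise constant criterion -/

/-! Suppose the levels `α`, `β` are within `|β₀ - α₀| / 8` of the true ones. Moving the split point
from the true change point `q` to `z` changes the least-squares sum by at least a positive multiple
of the sum of `κ ± e i` over the sample points between `q` and `z`, where `κ = 3 |β₀ - α₀| / 8`.
This is a random walk with positive drift. A point `z` that does no worse than `q` forces the walk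
to be nonpositive, and Chernoff's inequality makes this exponentially unlikely in `m |z - q|`.
Rounding `z` to the grid `q ± j / m` and summing the geometric tail over `j ≥ J` bounds the
probability of the event `exceptional`, uniformly in the sample size `m` and in `q`. This is
`exists_exceptional_bound`.

In the first stage the levels are themselves estimated. Their closeness (`levels_close`) follows
from a basic inequality for stumps, once all error sums over order intervals of the covariates are
small and both sides of `d₀` hold a positive fraction of the sample. The drift argument then gives
an error `O(1 / n₁)` for the first-stage change point. Since `γ < 1`, this is below the half-length
`K n₁ ^ (-γ)`, so `d₀` lies in the second-stage window.

An affine map sends the window to `[0, 1]` and `d₀` to a point `q` determined by the first sample.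
As the second sample is independent of the first and the bound is uniform in `q`, Fubini applies it
at this random `q`. The error is `O(1 / n₂)` in unit scale, hence `O(n₁ ^ (-γ) / n₂) = O(n ^ (-1 -
γ))` in the original one. -/

theorem eventually_le_iff_lt {m : ℕ} (x : Fin m → ℝ) (z : ℝ) :
    ∀ᶠ d in 𝓝[<] z, ∀ i, x i ≤ d ↔ x i < z := by
  rw [eventually_all]
  intro i
  rcases lt_or_ge (x i) z with h | h
  · filter_upwards [Ioo_mem_nhdsLT h] with d hd
    exact ⟨fun _ => h, fun _ => hd.1.le⟩
  · filter_upwards [self_mem_nhdsWithin] with d hd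
    exact ⟨fun h' => absurd (h'.trans_lt hd) h.not_gt, fun h' => absurd h' h.not_gt⟩

/-- Left limits of the criterion are attained arbitrarily close to the left. -/
theorem IsLeftLimitOn.exists_eq {m : ℕ} {x y : Fin m → ℝ} {α β z L : ℝ} {I : Set ℝ}
    (h : IsLeftLimitOn (lsCriterion x y α β) I z L) {r : ℝ} (hr : 0 < r) :
    ∃ d ∈ I, z - r < d ∧ d ≤ z ∧ lsCriterion x y α β d = L := by
  obtain ⟨hne, hL⟩ := h
  have hle : 𝓝[I ∩ Iio z] z ≤ 𝓝[<] z := nhdsWithin_mono _ inter_subset_right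
  -- The left limit is the criterion with strict comparisons.
  set c := (m : ℝ)⁻¹ * ∑ i, if x i < z then (y i - α) ^ 2 else (y i - β) ^ 2 with hc
  have hev : ∀ᶠ d in 𝓝[I ∩ Iio z] z, lsCriterion x y α β d = c := by
    filter_upwards [hle (eventually_le_iff_lt x z)] with d hd
    simp only [lsCriterion, hd, hc]
  have hLc : L = c := tendsto_nhds_unique hL (tendsto_const_nhds.congr' (hev.mono fun _ h => h.symm))
  have hgt : ∀ᶠ d in 𝓝[I ∩ Iio z] z, z - r < d :=
    hle (nhdsWithin_le_nhds (Ioi_mem_nhds (by linarith)))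
  obtain ⟨d, ⟨hd1, hd2⟩, hd3⟩ := ((hev.and hgt).and self_mem_nhdsWithin).exists
  exact ⟨d, hd3.1, hd2, hd3.2.le, by rw [hd1, hLc]⟩

theorem IsMinimizerOn.exists_near {m : ℕ} {x y : Fin m → ℝ} {α β z : ℝ} {I : Set ℝ}
    (h : IsMinimizerOn (lsCriterion x y α β) I z) {r : ℝ} (hr : 0 < r) :
    ∃ d ∈ I, z - r < d ∧ d ≤ z ∧ ∀ t ∈ I, lsCriterion x y α β d ≤ lsCriterion x y α β t := by
  obtain ⟨hz, v, hv, h | h⟩ := h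
  · exact ⟨z, hz, by linarith, le_rfl, fun t ht => h ▸ hv.2 (mem_image_of_mem _ ht)⟩
  · obtain ⟨d, hd, h1, h2, h3⟩ := h.exists_eq hr
    exact ⟨d, hd, h1, h2, fun t ht => h3 ▸ hv.2 (mem_image_of_mem _ ht)⟩

theorem IsLSMinimizer.exists_near {m : ℕ} {x y : Fin m → ℝ} {α β z : ℝ}
    (h : IsLSMinimizer x y α β z) {r : ℝ} (hr : 0 < r) :
    ∃ d ∈ Icc (0 : ℝ) 1, z - r < d ∧ d ≤ z ∧ ∀ a b, ∀ t ∈ Icc (0 : ℝ) 1,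
      lsCriterion x y α β d ≤ lsCriterion x y a b t := by
  obtain ⟨hz, v, hv, h | h⟩ := h
  · exact ⟨z, hz, by linarith, le_rfl, fun a b t ht => h ▸ hv.2 ⟨a, b, t, ht, rfl⟩⟩
  · obtain ⟨d, hd, h1, h2, h3⟩ := h.exists_eq hr
    exact ⟨d, hd, h1, h2, fun a b t ht => h3 ▸ hv.2 ⟨a, b, t, ht, rfl⟩⟩

/-! ### Rescaling to the unit interval -/

theorem rescale_le_iff {m : ℕ} {c h : ℝ} (hh : 0 < h) (v : Fin m → ℝ) (d : ℝ) (i : Fin m) :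
    rescale c h v i ≤ d ↔ v i ≤ (d - c + h) / (2 * h) := by
  rw [le_div_iff₀ (by positivity), rescale]
  constructor <;> intro h <;> linarith

/-- The criterion depends on the covariates only through their order relative to `d`, which an
increasing affine map preserves. -/
theorem lsCriterion_rescale {m : ℕ} {c h : ℝ} (hh : 0 < h) (v w : Fin m → ℝ) (α β d : ℝ) :
    lsCriterion (rescale c h v) w α β d = lsCriterion v w α β ((d - c + h) / (2 * h)) := by
  simp only [lsCriterion, rescale_le_iff hh]

theorem responses_rescale {m : ℕ} {c h : ℝ} (hh : 0 < h) (v e : Fin m → ℝ) (α β d : ℝ) :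
    responses α β d (rescale c h v) e = responses α β ((d - c + h) / (2 * h)) v e := by
  funext i
  simp only [responses, stump, rescale_le_iff hh]

/-! ### Localization of the minimizers -/

/-- The sum of `κ + τ eᵢ` over the sample points `vᵢ ∈ B`, minus the sum of `|eᵢ|` over those
in `R`. -/
noncomputable def excess {m : ℕ} (κ τ : ℝ) (B R : Set ℝ) (v e : Fin m → ℝ) : ℝ :=
  ∑ i, (B.indicator (fun _ => κ + τ * e i) (v i) - R.indicator (fun _ => |e i|) (v i))

/-- The triples `(q, v, e)` for which the excess over one of the intervals of length `j / m`,
`j ≥ J`, to the right or to the left of `q` is not positive. -/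
def exceptional (κ τ : ℝ) (m J : ℕ) : Set (ℝ × (Fin m → ℝ) × (Fin m → ℝ)) :=
  {p | p.1 ∈ Icc (0 : ℝ) 1 ∧ ∃ j : ℕ, J ≤ j ∧
    ((p.1 + j / m ≤ 1 ∧ excess κ τ (Ioc p.1 (p.1 + j / m))
        (Ioc (p.1 + j / m) (p.1 + (j + 1) / m)) p.2.1 p.2.2 ≤ 0) ∨
      (0 ≤ p.1 - j / m ∧ excess κ (-τ) (Ioc (p.1 - j / m) p.1)
        (Ioc (p.1 - (j + 1) / m) (p.1 - j / m)) p.2.1 p.2.2 ≤ 0))}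

/-- Only points between `q` and `z` change side. On the right of `q`, such a point contributes `2 (β
- α) (β₀ - (α + β) / 2 + e i)`. Up to the sign `τ`, the distance from `β₀` to the midpoint is at
least `|β₀ - α₀| / 2 - |β₀ - α₀| / 8`, whence the constant `3 / 8`; the left side is symmetric. -/
theorem sum_nonpos_of_lsCriterion_le {m : ℕ} (hm : 0 < m) {x e : Fin m → ℝ} {α₀ β₀ q α β τ z : ℝ}
    (hτ : τ = SignType.sign (β₀ - α₀)) (hαβ : α₀ ≠ β₀)
    (hα : |α - α₀| ≤ |β₀ - α₀| / 8) (hβ : |β - β₀| ≤ |β₀ - α₀| / 8)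
    (h : lsCriterion x (responses α₀ β₀ q x e) α β z ≤
      lsCriterion x (responses α₀ β₀ q x e) α β q) :
    (q < z → ∑ i, (Ioc q z).indicator (fun _ => 3 * |β₀ - α₀| / 8 + τ * e i) (x i) ≤ 0) ∧
    (z < q → ∑ i, (Ioc z q).indicator (fun _ => 3 * |β₀ - α₀| / 8 + -τ * e i) (x i) ≤ 0) := by
  have hm' : (0 : ℝ) < (m : ℝ)⁻¹ := by positivity
  have hs := le_of_mul_le_mul_left h hm'
  rw [← sub_nonpos, ← Finset.sum_sub_distrib] at hs
  set Δ := β₀ - α₀ with hΔ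
  have hΔ0 : Δ ≠ 0 := sub_ne_zero.2 hαβ.symm
  have hα' := abs_le.1 hα
  have hβ' := abs_le.1 hβ
  have hτΔ : τ * Δ = |Δ| := by rw [hτ]; exact sign_mul_self Δ
  have hpos : 0 < |Δ| := abs_pos.2 hΔ0
  have hτ1 : τ = 1 ∨ τ = -1 := by
    rcases lt_or_gt_of_ne hΔ0 with h | h <;> simp [hτ, h]
  -- The estimated jump keeps the sign of the true one, so this common factor can be divided out.
  have hc : 0 < 2 * τ * (β - α) := by
    rcases hτ1 with h | h <;> rw [h] at hτΔ ⊢ <;> nlinarith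
  constructor
  · intro hqz
    refine nonpos_of_mul_nonpos_right (le_trans ?_ hs) hc
    rw [Finset.mul_sum]
    refine Finset.sum_le_sum fun i _ => ?_
    by_cases h1 : x i ≤ q
    · have h2 : x i ≤ z := h1.trans hqz.le
      simp [indicator, h1, h2, h1.not_gt]
    · by_cases h2 : x i ≤ z
      · rw [indicator_of_mem (mem_Ioc.2 ⟨not_le.1 h1, h2⟩)]
        simp only [responses, stump, h1, h2, if_true, if_false]
        rcases hτ1 with h | h <;> rw [h] at hτΔ ⊢ <;> nlinarith
      · simp [indicator, h1, h2]
  · intro hqz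
    refine nonpos_of_mul_nonpos_right (le_trans ?_ hs) hc
    rw [Finset.mul_sum]
    refine Finset.sum_le_sum fun i _ => ?_
    by_cases h1 : x i ≤ z
    · have h2 : x i ≤ q := h1.trans hqz.le
      simp [indicator, h1, h2, h1.not_gt]
    · by_cases h2 : x i ≤ q
      · rw [indicator_of_mem (mem_Ioc.2 ⟨not_le.1 h1, h2⟩)]
        simp only [responses, stump, h1, h2, if_true, if_false]
        rcases hτ1 with h | h <;> rw [h] at hτΔ ⊢ <;> nlinarith
      · simp [indicator, h1, h2]

/-- Handles all `z` in a grid cell at once: `D` is the interval between `q` and `z`, `B` its part up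
to the last grid point, `R` the remaining cell. Each point of `R` contributes at least `-|e i|`,
whether or not it lies in `D`. -/
theorem excess_le_sum {m : ℕ} {κ τ : ℝ} (hκ : 0 ≤ κ) (hτ : |τ| ≤ 1) {B R D : Set ℝ}
    (hBD : B ⊆ D) (hDR : D ⊆ B ∪ R) (hBR : Disjoint B R) (v e : Fin m → ℝ) :
    excess κ τ B R v e ≤ ∑ i, D.indicator (fun _ => κ + τ * e i) (v i) := by
  refine Finset.sum_le_sum fun i _ => ?_
  have hb : -|e i| ≤ τ * e i := by
    refine (neg_le_neg ?_).trans (neg_abs_le _)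
    rw [abs_mul]
    exact mul_le_of_le_one_left (abs_nonneg _) hτ
  by_cases h1 : v i ∈ B
  · rw [indicator_of_mem h1, indicator_of_notMem (disjoint_left.1 hBR h1),
      indicator_of_mem (hBD h1)]
    simp
  · rw [indicator_of_notMem h1]
    by_cases h2 : v i ∈ R
    · rw [indicator_of_mem h2]
      by_cases h3 : v i ∈ D
      · rw [indicator_of_mem h3]; linarith
      · rw [indicator_of_notMem h3]; linarith [abs_nonneg (e i)]
    · rw [indicator_of_notMem h2, indicator_of_notMem]
      · simp
      · exact fun h => (hDR h).elim h1 h2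

/-- Outside the exceptional set, points at which the criterion is at most its value at the change
point `q` are within `J / m` of `q`. -/
theorem abs_sub_le_of_notMem_exceptional {m J : ℕ} (hm : 0 < m) {x e : Fin m → ℝ}
    {α₀ β₀ q α β τ z : ℝ} (hτ : τ = SignType.sign (β₀ - α₀)) (hαβ : α₀ ≠ β₀)
    (hα : |α - α₀| ≤ |β₀ - α₀| / 8) (hβ : |β - β₀| ≤ |β₀ - α₀| / 8)
    (hq : q ∈ Icc (0 : ℝ) 1) (hz : z ∈ Icc (0 : ℝ) 1)
    (hx : (q, x, e) ∉ exceptional (3 * |β₀ - α₀| / 8) τ m J)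
    (h : lsCriterion x (responses α₀ β₀ q x e) α β z ≤
      lsCriterion x (responses α₀ β₀ q x e) α β q) :
    |z - q| ≤ J / m := by
  have hm' : (0 : ℝ) < m := by positivity
  obtain ⟨h1, h2⟩ := sum_nonpos_of_lsCriterion_le hm hτ hαβ hα hβ h
  have hτ1 : |τ| ≤ 1 := by
    rcases lt_trichotomy (β₀ - α₀) 0 with h | h | h <;> simp [hτ, h]
  have hκ : 0 ≤ 3 * |β₀ - α₀| / 8 := by positivity
  by_contra! hc
  -- The index of the grid cell of length `1 / m` containing `z`, counted from `q`.
  have hj : J ≤ ⌊m * |z - q|⌋₊ := Nat.le_floor (by rw [div_lt_iff₀ hm'] at hc; linarith)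
  set j := ⌊m * |z - q|⌋₊ with hjdef
  have hj1 : (j : ℝ) / m ≤ |z - q| := by
    rw [div_le_iff₀ hm', mul_comm]; exact Nat.floor_le (by positivity)
  have hj2 : |z - q| < ((j : ℝ) + 1) / m := by
    rw [lt_div_iff₀ hm', mul_comm]; exact Nat.lt_floor_add_one _
  have hj0 : (0 : ℝ) ≤ j / m := by positivity
  have hpos : 0 < |z - q| := lt_of_le_of_lt (by positivity) hc
  refine hx ⟨hq, j, hj, ?_⟩
  rcases lt_or_gt_of_ne (sub_ne_zero.1 (abs_pos.1 hpos)) with hlt | hlt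
  · right
    rw [abs_sub_comm, abs_of_pos (sub_pos.2 hlt)] at hj1 hj2
    refine ⟨by simp only; linarith [hz.1],
      (excess_le_sum hκ (by rwa [abs_neg]) ?_ ?_ ?_ _ _).trans (h2 hlt)⟩
    · exact Ioc_subset_Ioc_left (by simp only; linarith)
    · rw [union_comm]
      refine subset_trans ?_ Ioc_subset_Ioc_union_Ioc
      exact Ioc_subset_Ioc_left (by simp only; linarith)
    · exact (Ioc_disjoint_Ioc_of_le le_rfl).symm
  · left
    rw [abs_of_pos (sub_pos.2 hlt)] at hj1 hj2
    refine ⟨by simp only; linarith [hz.2], (excess_le_sum hκ hτ1 ?_ ?_ ?_ _ _).trans (h1 hlt)⟩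
    · exact Ioc_subset_Ioc_right (by simp only; linarith)
    · refine subset_trans ?_ Ioc_subset_Ioc_union_Ioc
      exact Ioc_subset_Ioc_right (by simp only; linarith)
    · exact Ioc_disjoint_Ioc_of_le le_rfl

/-! ### Closeness of the first-stage levels -/

/-- The sample points between the `i`-th and the `j`-th. -/
noncomputable def between {m : ℕ} (x : Fin m → ℝ) (i j : Fin m) : Finset (Fin m) :=
  {k | x i ≤ x k ∧ x k ≤ x j}

/-- The sample points in any interval are those between their smallest and largest member, so `m ^
2` index sets account for all nonempty cases. -/
theorem sum_sq_le_of_ordConnected {m : ℕ} {x e : Fin m → ℝ} {b : ℝ}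
    (hb : ∀ i j, (∑ k ∈ between x i j, e k) ^ 2 ≤ b * (between x i j).card)
    {D : Set ℝ} (hD : D.OrdConnected) {S : Finset (Fin m)} (hS : ∀ k, k ∈ S ↔ x k ∈ D) :
    (∑ k ∈ S, e k) ^ 2 ≤ b * S.card := by
  rcases S.eq_empty_or_nonempty with rfl | hne
  · simp
  · obtain ⟨i, hi, hi'⟩ := S.exists_min_image x hne
    obtain ⟨j, hj, hj'⟩ := S.exists_max_image x hne
    have : S = between x i j := by
      ext k
      simp only [between, Finset.mem_filter, Finset.mem_univ, true_and]
      exact ⟨fun hk => ⟨hi' k hk, hj' k hk⟩,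
        fun hk => (hS k).2 (hD.out ((hS i).1 hi) ((hS j).1 hj) hk)⟩
    rw [this]
    exact hb i j

theorem two_mul_le_of_sq_le {z p q : ℝ} (hp : 0 ≤ p) (hq : 0 ≤ q) (h : z ^ 2 ≤ p * q) :
    2 * z ≤ p / 2 + 2 * q := by
  refine abs_le_of_sq_le_sq' ?_ (by positivity) |>.2
  nlinarith [sq_nonneg (p / 2 - 2 * q)]

/-- The cross term is absorbed by the arithmetic-geometric mean inequality, weighted so that half of
the quadratic term survives. -/
theorem piece_sum_ge {m : ℕ} {e g : Fin m → ℝ} {a b : ℝ} (hb0 : 0 ≤ b) {S : Finset (Fin m)}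
    (hS : (∑ k ∈ S, e k) ^ 2 ≤ b * S.card) (hg : ∀ k ∈ S, g k = a) :
    a ^ 2 * S.card / 2 - 2 * b ≤ ∑ k ∈ S, (g k ^ 2 - 2 * g k * e k) := by
  have h1 : ∑ k ∈ S, (g k ^ 2 - 2 * g k * e k) = a ^ 2 * S.card - 2 * (a * ∑ k ∈ S, e k) := by
    rw [Finset.sum_congr rfl fun k hk => by rw [hg k hk], Finset.sum_sub_distrib,
      Finset.sum_const, nsmul_eq_mul, ← Finset.mul_sum]
    ring
  have h2 := two_mul_le_of_sq_le (z := a * ∑ k ∈ S, e k) (p := a ^ 2 * S.card) (q := b)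
    (by positivity) hb0 (by rw [mul_pow, mul_assoc, mul_comm (S.card : ℝ)]; gcongr)
  rw [h1]; linarith

/-- Here `g` is the fitted minus the true step function, and the sum is the excess of the residual
sum of squares. Three pieces lose at most `2 * b` each, so no surviving term `a ^ 2 * N / 2` exceeds
`6 * b`. -/
theorem three_pieces_bound {m : ℕ} {x e : Fin m → ℝ} {b : ℝ} (hb0 : 0 ≤ b)
    (hb : ∀ i j, (∑ k ∈ between x i j, e k) ^ 2 ≤ b * (between x i j).card)
    {p r a₁ a₂ a₃ : ℝ} (hpr : p ≤ r) {g : Fin m → ℝ}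
    (hg₁ : ∀ i, x i ≤ p → g i = a₁) (hg₂ : ∀ i, p < x i → x i ≤ r → g i = a₂)
    (hg₃ : ∀ i, r < x i → g i = a₃)
    (hg : ∑ i, (g i ^ 2 - 2 * g i * e i) ≤ 0) :
    a₁ ^ 2 * (Finset.univ.filter fun i => x i ≤ p).card ≤ 12 * b ∧
    a₂ ^ 2 * (Finset.univ.filter fun i => p < x i ∧ x i ≤ r).card ≤ 12 * b ∧
    a₃ ^ 2 * (Finset.univ.filter fun i => r < x i).card ≤ 12 * b := by
  have h1 := piece_sum_ge (g := g) (a := a₁) hb0 (sum_sq_le_of_ordConnected hb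
    (S := Finset.univ.filter fun i => x i ≤ p) (D := Iic p) ordConnected_Iic (by simp))
    (by simpa using hg₁)
  have h2 := piece_sum_ge (g := g) (a := a₂) hb0 (sum_sq_le_of_ordConnected hb
    (S := Finset.univ.filter fun i => p < x i ∧ x i ≤ r) (D := Ioc p r) ordConnected_Ioc (by simp))
    (by simpa using hg₂)
  have h3 := piece_sum_ge (g := g) (a := a₃) hb0 (sum_sq_le_of_ordConnected hb
    (S := Finset.univ.filter fun i => r < x i) (D := Ioi r) ordConnected_Ioi (by simp))
    (by simpa using hg₃)
  have h4 : ∑ i, (g i ^ 2 - 2 * g i * e i) =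
      ∑ i with x i ≤ p, (g i ^ 2 - 2 * g i * e i) +
      (∑ i with p < x i ∧ x i ≤ r, (g i ^ 2 - 2 * g i * e i) +
      ∑ i with r < x i, (g i ^ 2 - 2 * g i * e i)) := by
    simp only [Finset.sum_filter, ← Finset.sum_add_distrib]
    refine Finset.sum_congr rfl fun i _ => ?_
    rcases le_or_gt (x i) p with h | h
    · simp [h, h.not_gt, (h.trans hpr).not_gt]
    · rcases le_or_gt (x i) r with h' | h'
      · simp [h, h.not_ge, h', h'.not_gt]
      · simp [h.not_ge, h', h'.not_ge]
  have p1 : 0 ≤ a₁ ^ 2 * (Finset.univ.filter fun i => x i ≤ p).card := by positivity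
  have p2 : 0 ≤ a₂ ^ 2 * (Finset.univ.filter fun i => p < x i ∧ x i ≤ r).card := by positivity
  have p3 : 0 ≤ a₃ ^ 2 * (Finset.univ.filter fun i => r < x i).card := by positivity
  refine ⟨?_, ?_, ?_⟩ <;> linarith

/-- Deterministic consistency of the levels of a least-squares stump. -/
theorem levels_close {m : ℕ} (hm : 0 < m) {x e : Fin m → ℝ} {α₀ β₀ d₀ α β d c : ℝ} (hc : 0 < c)
    (hαβ : α₀ ≠ β₀)
    (hb : ∀ i j, (∑ k ∈ between x i j, e k) ^ 2 ≤
      (c * (β₀ - α₀) ^ 2 / 2000 * m) * (between x i j).card)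
    (hl : c * m ≤ (Finset.univ.filter fun i => x i ≤ d₀).card)
    (hr : c * m ≤ (Finset.univ.filter fun i => d₀ < x i).card)
    (h : lsCriterion x (responses α₀ β₀ d₀ x e) α β d ≤
      lsCriterion x (responses α₀ β₀ d₀ x e) α₀ β₀ d₀) :
    |α - α₀| ≤ |β₀ - α₀| / 8 ∧ |β - β₀| ≤ |β₀ - α₀| / 8 := by
  have hm' : (0 : ℝ) < m := by positivity
  have hΔ : 0 < (β₀ - α₀) ^ 2 := by
    have := sub_ne_zero.2 hαβ.symm
    positivity
  set b := c * (β₀ - α₀) ^ 2 / 2000 * m with hbdef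
  have hb0 : 0 ≤ b := by positivity
  have hcm : 0 < c * m := by positivity
  have hs := le_of_mul_le_mul_left h (by positivity)
  rw [← sub_nonpos, ← Finset.sum_sub_distrib] at hs
  -- The constant `2000` enters here: `a ^ 2 ≤ 24 * b / (c * m)`, and `24 / 2000 < 1 / 64`.
  have small : ∀ {a N : ℝ}, c * m / 2 ≤ N → a ^ 2 * N ≤ 12 * b →
      a ^ 2 ≤ (|β₀ - α₀| / 8) ^ 2 := by
    intro a N hN ha
    have h1 : a ^ 2 * (c * m / 2) ≤ 12 * b := (by gcongr : _ ≤ a ^ 2 * N).trans ha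
    rw [div_pow, sq_abs]
    have h2 : (c * m) * a ^ 2 ≤ (c * m) * ((β₀ - α₀) ^ 2 / 8 ^ 2) := by
      rw [hbdef] at h1
      nlinarith [mul_pos hcm hΔ]
    exact le_of_mul_le_mul_left h2 hcm
  have small' : ∀ {a N : ℝ}, c * m / 2 ≤ N → a ^ 2 * N ≤ 12 * b →
      |a| ≤ |β₀ - α₀| / 8 := fun hN ha => abs_le_of_sq_le_sq (small hN ha) (by positivity)
  have far : ∀ {a a' : ℝ}, |a| ≤ |β₀ - α₀| / 8 → |a'| ≤ |β₀ - α₀| / 8 →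
      a' - a ≠ β₀ - α₀ := by
    intro a a' h1 h2 h3
    have h4 := abs_sub a' a
    rw [h3] at h4
    have : 0 < |β₀ - α₀| := abs_pos.2 (sub_ne_zero.2 hαβ.symm)
    linarith
  rcases le_or_gt d d₀ with hd | hd
  · obtain ⟨h1, h2, h3⟩ := three_pieces_bound hb0 hb hd (a₁ := α - α₀) (a₂ := β - α₀)
      (a₃ := β - β₀)
      (g := fun i => (if x i ≤ d then α else β) - (if x i ≤ d₀ then α₀ else β₀))
      (fun i hi => by simp [hi, hi.trans hd]) (fun i hi hi' => by simp [hi.not_ge, hi'])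
      (fun i hi => by simp [hi.not_ge, (hd.trans_lt hi).not_ge]) (by
        refine le_trans (le_of_eq (Finset.sum_congr rfl fun i _ => ?_)) hs
        simp only [responses, stump]
        split_ifs <;> ring)
    have hβ := small' (a := β - β₀) (by linarith) h3
    refine ⟨?_, hβ⟩
    have hcard : ((Finset.univ.filter fun i => x i ≤ d₀).card : ℝ) =
        (Finset.univ.filter fun i => x i ≤ d).card +
        (Finset.univ.filter fun i => d < x i ∧ x i ≤ d₀).card := by
      rw [← Nat.cast_add, ← Finset.card_union_of_disjoint]
      · congr 2
        ext i
        simp only [Finset.mem_union, Finset.mem_filter, Finset.mem_univ, true_and]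
        constructor
        · intro h
          rcases le_or_gt (x i) d with h' | h'
          exacts [Or.inl h', Or.inr ⟨h', h⟩]
        · rintro (h | h)
          exacts [h.trans hd, h.2]
      · rw [Finset.disjoint_filter]
        intro i _ h1 h2
        exact absurd h2.1 h1.not_gt
    -- The points left of `d₀` are split in two by `d`, and one part has at least `c * m / 2` of
    -- them. It cannot be the middle one, as `β` would then be close to both `α₀` and `β₀`.
    by_cases hN : c * m / 2 ≤ (Finset.univ.filter fun i => d < x i ∧ x i ≤ d₀).card
    · exact absurd (by ring) (far hβ (small' hN h2))
    · push Not at hN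
      exact small' (by linarith) h1
  · obtain ⟨h1, h2, h3⟩ := three_pieces_bound hb0 hb hd.le (a₁ := α - α₀) (a₂ := α - β₀)
      (a₃ := β - β₀)
      (g := fun i => (if x i ≤ d then α else β) - (if x i ≤ d₀ then α₀ else β₀))
      (fun i hi => by simp [hi, hi.trans hd.le]) (fun i hi hi' => by simp [hi.not_ge, hi'])
      (fun i hi => by simp [hi.not_ge, (hd.trans hi).not_ge]) (by
        refine le_trans (le_of_eq (Finset.sum_congr rfl fun i _ => ?_)) hs
        simp only [responses, stump]
        split_ifs <;> ring)
    have hα := small' (a := α - α₀) (by linarith) h1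
    refine ⟨hα, ?_⟩
    have hcard : ((Finset.univ.filter fun i => d₀ < x i).card : ℝ) =
        (Finset.univ.filter fun i => d < x i).card +
        (Finset.univ.filter fun i => d₀ < x i ∧ x i ≤ d).card := by
      rw [← Nat.cast_add, ← Finset.card_union_of_disjoint]
      · congr 2
        ext i
        simp only [Finset.mem_union, Finset.mem_filter, Finset.mem_univ, true_and]
        constructor
        · intro h
          rcases le_or_gt (x i) d with h' | h'
          exacts [Or.inr ⟨h, h'⟩, Or.inl h']
        · rintro (h | h)
          exacts [hd.trans h, h.1]
      · rw [Finset.disjoint_filter]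
        intro i _ h1 h2
        exact absurd h1 h2.2.not_gt
    by_cases hN : c * m / 2 ≤ (Finset.univ.filter fun i => d₀ < x i ∧ x i ≤ d).card
    · exact absurd (by ring) (far (small' hN h2) hα)
    · push Not at hN
      exact small' (by linarith) h3

/-! ### Exponential moments -/

theorem exp_le_quadratic_mul_exp_abs (y : ℝ) : Real.exp y ≤ 1 + y + y ^ 2 * Real.exp |y| := by
  have h := Complex.norm_exp_sub_sum_le_norm_mul_exp (y : ℂ) 2
  have h2 : Complex.exp y - ∑ k ∈ Finset.range 2, (y : ℂ) ^ k / k.factorial =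
      ((Real.exp y - (1 + y) : ℝ) : ℂ) := by
    simp [Finset.sum_range_succ]
  rw [h2, Complex.norm_real, Complex.norm_real, Real.norm_eq_abs, Real.norm_eq_abs, sq_abs] at h
  linarith [le_abs_self (Real.exp y - (1 + y))]

/-- With mean zero, the linear term of the expansion integrates to `0`, leaving a sub-Gaussian bound
near the origin. -/
theorem exists_mgf_bound {ν : Measure ℝ} [IsProbabilityMeasure ν] (hmean : ∫ x, x ∂ν = 0)
    (hmgf : ∀ᶠ t in 𝓝 (0 : ℝ), Integrable (fun x => Real.exp (t * x)) ν) :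
    ∃ s > 0, ∃ C > 0, Integrable (fun x => Real.exp (s * |x|)) ν ∧
      ∀ t, |t| ≤ s → Integrable (fun x => Real.exp (t * x)) ν ∧
        ∫ x, Real.exp (t * x) ∂ν ≤ Real.exp (C * t ^ 2) := by
  obtain ⟨r, hr, hball⟩ := Metric.eventually_nhds_iff.1 hmgf
  have hint : ∀ t, |t| < r → Integrable (fun x => Real.exp (t * x)) ν := fun t ht =>
    hball (by simpa using ht)
  have habs : ∀ t, 0 ≤ t → t < r → Integrable (fun x => Real.exp (t * |x|)) ν := by
    intro t ht0 ht
    refine ((hint t (by rwa [abs_of_nonneg ht0])).add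
      (hint (-t) (by rwa [abs_neg, abs_of_nonneg ht0]))).mono' (by fun_prop)
      (Eventually.of_forall fun x => ?_)
    rw [Real.norm_eq_abs, Real.abs_exp, Pi.add_apply]
    rcases abs_cases x with ⟨h, _⟩ | ⟨h, _⟩ <;> rw [h]
    · linarith [Real.exp_pos (-t * x)]
    · rw [mul_neg, ← neg_mul]; linarith [Real.exp_pos (t * x)]
  -- Leaves room for `2 * s < r`: the factor `x ^ 2` is absorbed into a second `exp (s * |x|)`.
  set s := r / 4 with hs
  have hs0 : 0 < s := by positivity
  have hsq : Integrable (fun x => x ^ 2 * Real.exp (s * |x|)) ν := by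
    refine ((habs (2 * s) (by positivity) (by linarith)).const_mul (2 / s ^ 2)).mono' (by fun_prop)
      (Eventually.of_forall fun x => ?_)
    rw [Real.norm_eq_abs, abs_of_nonneg (by positivity), two_mul, add_mul, Real.exp_add,
      ← mul_assoc]
    gcongr
    have h := Real.quadratic_le_exp_of_nonneg (x := s * |x|) (by positivity)
    have h1 : (s * |x|) ^ 2 = s ^ 2 * x ^ 2 := by rw [mul_pow, sq_abs]
    rw [div_mul_eq_mul_div, le_div_iff₀ (by positivity)]
    have h2 : 0 ≤ s * |x| := by positivity
    nlinarith
  have hid : Integrable (fun x : ℝ => x) ν := by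
    refine ((habs s hs0.le (by linarith)).const_mul (1 / s)).mono' (by fun_prop)
      (Eventually.of_forall fun x => ?_)
    rw [Real.norm_eq_abs, div_mul_eq_mul_div, one_mul, le_div_iff₀ hs0]
    linarith [Real.add_one_le_exp (s * |x|)]
  -- The summand `1` only ensures positivity.
  refine ⟨s, hs0, 1 + ∫ x, x ^ 2 * Real.exp (s * |x|) ∂ν,
    by have : 0 ≤ ∫ x, x ^ 2 * Real.exp (s * |x|) ∂ν := integral_nonneg fun x => by positivity
       linarith, habs s hs0.le (by linarith), fun t ht =>
    ⟨hint t (by linarith), ?_⟩⟩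
  calc ∫ x, Real.exp (t * x) ∂ν
      ≤ ∫ x, (1 + t * x + t ^ 2 * (x ^ 2 * Real.exp (s * |x|))) ∂ν := by
        refine integral_mono (hint t (by linarith)) (((integrable_const 1).add
          (hid.const_mul t)).add (hsq.const_mul (t ^ 2))) fun x => ?_
        refine (exp_le_quadratic_mul_exp_abs (t * x)).trans ?_
        rw [mul_pow, mul_assoc, abs_mul]
        gcongr
    _ = 1 + t ^ 2 * ∫ x, x ^ 2 * Real.exp (s * |x|) ∂ν := by
        have hlin : Integrable (fun x => 1 + t * x) ν := (integrable_const 1).add (hid.const_mul t)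
        rw [integral_add hlin (hsq.const_mul (t ^ 2)),
          integral_add (integrable_const 1) (hid.const_mul t), integral_const_mul,
          integral_const_mul, hmean]
        simp
    _ ≤ Real.exp (t ^ 2 * ∫ x, x ^ 2 * Real.exp (s * |x|) ∂ν) := by
        rw [add_comm]; exact Real.add_one_le_exp _
    _ ≤ _ := by
        rw [Real.exp_le_exp]
        nlinarith [sq_nonneg t]

/-- Chernoff's inequality at threshold `0`. -/
theorem measure_pi_sum_nonpos_le {E : Type*} [MeasurableSpace E] {ρ : Measure E}
    [IsProbabilityMeasure ρ] {g : E → ℝ} (hg : Measurable g) {t b : ℝ} (ht : 0 ≤ t)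
    (hint : Integrable (fun x => Real.exp (-t * g x)) ρ)
    (hb : ∫ x, Real.exp (-t * g x) ∂ρ ≤ b) (m : ℕ) :
    (Measure.pi fun _ : Fin m => ρ).real {ω | ∑ i, g (ω i) ≤ 0} ≤ b ^ m := by
  set M := Measure.pi fun _ : Fin m => ρ with hM
  have hind : iIndepFun (fun (i : Fin m) (ω : Fin m → E) => g (ω i)) M :=
    iIndepFun_pi (X := fun _ => g) fun _ => hg.aemeasurable
  have hmp : ∀ i : Fin m, MeasurePreserving (Function.eval i) M ρ := fun i =>
    measurePreserving_eval (fun _ : Fin m => ρ) i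
  have hmeas : ∀ i : Fin m, Measurable fun ω : Fin m → E => g (ω i) := fun i => by fun_prop
  have hint' : ∀ i : Fin m, Integrable (fun ω : Fin m → E => Real.exp (-t * g (ω i))) M :=
    fun i => (hmp i).integrable_comp_of_integrable hint
  have hmgf : ∀ i : Fin m, mgf (fun ω : Fin m → E => g (ω i)) M (-t) =
      ∫ x, Real.exp (-t * g x) ∂ρ := fun i => by
    rw [mgf, ← (hmp i).map_eq, integral_map (hmp i).measurable.aemeasurable (by fun_prop)]
  have h := measure_le_le_exp_mul_mgf (μ := M) (X := ∑ i, fun ω : Fin m → E => g (ω i)) 0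
    (neg_nonpos.2 ht) (hind.integrable_exp_mul_sum hmeas fun i _ => hint' i)
  rw [hind.mgf_sum hmeas] at h
  simp only [mul_zero, Real.exp_zero, one_mul, hmgf, Finset.prod_const, Finset.card_univ,
    Fintype.card_fin, Finset.sum_apply] at h
  exact h.trans (pow_le_pow_left₀ (integral_nonneg fun x => (Real.exp_pos _).le) hb m)

/-! ### The law of a sample -/

/-- The uniform distribution on `[0, 1]`. -/
noncomputable def unif : Measure ℝ := volume.restrict (Icc (0 : ℝ) 1)

instance : IsProbabilityMeasure unif := ⟨by simp [unif]⟩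

/-- The law of `m` i.i.d. uniform covariates and `m` i.i.d. errors with law `ν`. -/
noncomputable def sampleLaw (ν : Measure ℝ) (m : ℕ) : Measure ((Fin m → ℝ) × (Fin m → ℝ)) :=
  (Measure.pi fun _ => unif).prod (Measure.pi fun _ => ν)

instance (ν : Measure ℝ) [IsProbabilityMeasure ν] (m : ℕ) : IsProbabilityMeasure (sampleLaw ν m) :=
  inferInstanceAs (IsProbabilityMeasure (Measure.prod _ _))

theorem sampleLaw_sum_nonpos_le {ν : Measure ℝ} [IsProbabilityMeasure ν] {g : ℝ × ℝ → ℝ}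
    (hg : Measurable g) {t b : ℝ} (ht : 0 ≤ t)
    (hint : Integrable (fun x => Real.exp (-t * g x)) (unif.prod ν))
    (hb : ∫ x, Real.exp (-t * g x) ∂(unif.prod ν) ≤ b) (m : ℕ) :
    (sampleLaw ν m).real {p | ∑ i, g (p.1 i, p.2 i) ≤ 0} ≤ b ^ m := by
  have h := measure_pi_sum_nonpos_le hg ht hint hb m
  have hmp := measurePreserving_arrowProdEquivProdArrow ℝ ℝ (Fin m) (fun _ => unif) (fun _ => ν)
  have hS : MeasurableSet {p : (Fin m → ℝ) × (Fin m → ℝ) | ∑ i, g (p.1 i, p.2 i) ≤ 0} :=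
    measurableSet_le (by fun_prop) measurable_const
  rw [measureReal_def, sampleLaw, ← hmp.measure_preimage hS.nullMeasurableSet]
  exact h

/-- As `B` and `R` are disjoint, the exponential is `1` plus one correction supported on each, and
each correction is a product of a function of the covariate and one of the error. -/
theorem integral_exp_excess {ν : Measure ℝ} [IsProbabilityMeasure ν] {κ τ t : ℝ} {B R : Set ℝ}
    (hB : MeasurableSet B) (hR : MeasurableSet R) (hBR : Disjoint B R)
    (h1 : Integrable (fun x => Real.exp (-t * (κ + τ * x))) ν)
    (h2 : Integrable (fun x => Real.exp (t * |x|)) ν) :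
    Integrable (fun p : ℝ × ℝ => Real.exp (-t * (B.indicator (fun _ => κ + τ * p.2) p.1 -
      R.indicator (fun _ => |p.2|) p.1))) (unif.prod ν) ∧
    ∫ p : ℝ × ℝ, Real.exp (-t * (B.indicator (fun _ => κ + τ * p.2) p.1 -
      R.indicator (fun _ => |p.2|) p.1)) ∂(unif.prod ν) =
    1 + unif.real B * (∫ x, Real.exp (-t * (κ + τ * x)) ∂ν - 1) +
      unif.real R * (∫ x, Real.exp (t * |x|) ∂ν - 1) := by
  have hIB : Integrable (B.indicator (1 : ℝ → ℝ)) unif := (integrable_indicator_iff hB).2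
    (integrable_const (1 : ℝ)).integrableOn
  have hIR : Integrable (R.indicator (1 : ℝ → ℝ)) unif := (integrable_indicator_iff hR).2
    (integrable_const (1 : ℝ)).integrableOn
  have h1' : Integrable (fun p : ℝ × ℝ => B.indicator (1 : ℝ → ℝ) p.1 *
      (Real.exp (-t * (κ + τ * p.2)) - 1)) (unif.prod ν) :=
    hIB.mul_prod (h1.sub (integrable_const 1))
  have h2' : Integrable (fun p : ℝ × ℝ => R.indicator (1 : ℝ → ℝ) p.1 *
      (Real.exp (t * |p.2|) - 1)) (unif.prod ν) :=
    hIR.mul_prod (h2.sub (integrable_const 1))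
  have h3 : Integrable (fun p : ℝ × ℝ => 1 + B.indicator (1 : ℝ → ℝ) p.1 *
      (Real.exp (-t * (κ + τ * p.2)) - 1)) (unif.prod ν) := (integrable_const 1).add h1'
  have key : (fun p : ℝ × ℝ => Real.exp (-t * (B.indicator (fun _ => κ + τ * p.2) p.1 -
      R.indicator (fun _ => |p.2|) p.1))) = fun p =>
      1 + B.indicator (1 : ℝ → ℝ) p.1 * (Real.exp (-t * (κ + τ * p.2)) - 1) +
      R.indicator (1 : ℝ → ℝ) p.1 * (Real.exp (t * |p.2|) - 1) := by
    funext p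
    by_cases hb : p.1 ∈ B
    · have hr := disjoint_left.1 hBR hb
      simp [hb, hr]
    · by_cases hr : p.1 ∈ R <;> simp [hb, hr]
  rw [key]
  refine ⟨h3.add h2', ?_⟩
  have e1 := integral_prod_mul (μ := unif) (ν := ν) (B.indicator (1 : ℝ → ℝ))
    (fun x => Real.exp (-t * (κ + τ * x)) - 1)
  have e2 := integral_prod_mul (μ := unif) (ν := ν) (R.indicator (1 : ℝ → ℝ))
    (fun x => Real.exp (t * |x|) - 1)
  rw [integral_indicator_one hB, integral_sub h1 (integrable_const 1)] at e1
  rw [integral_indicator_one hR, integral_sub h2 (integrable_const 1)] at e2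
  rw [integral_add h3 h2', integral_add (integrable_const 1) h1', e1, e2]
  simp

/-! ### The probability of the exceptional set -/

/-- One observation has exponential moment at most `1 + (D - a * j) / m ≤ exp ((D - a * j) / m)`;
the `m`-th power no longer depends on `m`. -/
theorem exists_excess_nonpos_bound {ν : Measure ℝ} [IsProbabilityMeasure ν]
    (hmean : ∫ x, x ∂ν = 0)
    (hmgf : ∀ᶠ t in 𝓝 (0 : ℝ), Integrable (fun x => Real.exp (t * x)) ν) {κ : ℝ} (hκ : 0 < κ) :
    ∃ a > 0, ∃ D : ℝ, ∀ τ : ℝ, |τ| = 1 → ∀ (m j : ℕ) (B R : Set ℝ), 0 < m → MeasurableSet B →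
      MeasurableSet R → Disjoint B R → (j : ℝ) / m ≤ unif.real B → unif.real R ≤ 1 / m →
      (sampleLaw ν m).real {p | excess κ τ B R p.1 p.2 ≤ 0} ≤ Real.exp (D - a * j) := by
  obtain ⟨s, hs, C, hC, hsint, hsbd⟩ := exists_mgf_bound hmean hmgf
  -- Chosen so that `-t * κ + C * t ^ 2 ≤ -t * κ / 2`.
  set t := min s (κ / (2 * C)) with ht
  have ht0 : 0 < t := lt_min hs (by positivity)
  have hts : t ≤ s := min_le_left _ _
  have htC : C * t ≤ κ / 2 := by
    have : t ≤ κ / (2 * C) := min_le_right _ _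
    rw [le_div_iff₀ (by positivity)] at this
    linarith
  have habs : Integrable (fun x => Real.exp (t * |x|)) ν := by
    refine hsint.mono' (by fun_prop) (Eventually.of_forall fun x => ?_)
    rw [Real.norm_eq_abs, Real.abs_exp]
    gcongr
  set D := ∫ x, Real.exp (t * |x|) ∂ν - 1 with hD
  have hD0 : 0 ≤ D := by
    have h : ∫ _, (1 : ℝ) ∂ν ≤ ∫ x, Real.exp (t * |x|) ∂ν :=
      integral_mono (integrable_const 1) habs fun x => Real.one_le_exp (by positivity)
    simp only [integral_const, probReal_univ, smul_eq_mul, mul_one] at h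
    linarith
  refine ⟨1 - Real.exp (-(t * κ / 2)), sub_pos.2 (Real.exp_lt_one_iff.2 (by
    have : 0 < t * κ := by positivity
    linarith)), D, ?_⟩
  intro τ hτ m j B R hm hB hR hBR hjB hR1
  have hm' : (0 : ℝ) < m := by positivity
  have hfac : (fun x : ℝ => Real.exp (-t * (κ + τ * x))) =
      fun x => Real.exp (-t * κ) * Real.exp ((-t * τ) * x) := by
    funext x; rw [← Real.exp_add]; ring_nf
  have htτ : |-t * τ| ≤ s := by rw [abs_mul, hτ, abs_neg, abs_of_pos ht0, mul_one]; exact hts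
  obtain ⟨hi, hle⟩ := hsbd _ htτ
  have hint1 : Integrable (fun x : ℝ => Real.exp (-t * (κ + τ * x))) ν := by
    rw [hfac]; exact hi.const_mul _
  have hφ : ∫ x, Real.exp (-t * (κ + τ * x)) ∂ν ≤ Real.exp (-(t * κ / 2)) := by
    rw [hfac, integral_const_mul]
    refine (mul_le_mul_of_nonneg_left hle (Real.exp_pos _).le).trans ?_
    rw [← Real.exp_add, Real.exp_le_exp, mul_pow, ← sq_abs τ, hτ]
    nlinarith
  obtain ⟨hI, hE⟩ := integral_exp_excess (ν := ν) (κ := κ) (τ := τ) (t := t) hB hR hBR hint1 habs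
  have hmeas : Measurable fun p : ℝ × ℝ => B.indicator (fun _ => κ + τ * p.2) p.1 -
      R.indicator (fun _ => |p.2|) p.1 := by
    simp only [indicator]
    refine (Measurable.ite (measurable_fst hB) (by fun_prop) measurable_const).sub
      (Measurable.ite (measurable_fst hR) (by fun_prop) measurable_const)
  have h := sampleLaw_sum_nonpos_le hmeas ht0.le hI
    (b := Real.exp ((D - (1 - Real.exp (-(t * κ / 2))) * j) / m)) ?_ m
  · rw [← Real.exp_nat_mul, mul_div_cancel₀ _ hm'.ne'] at h
    exact h
  · rw [hE]
    refine le_trans ?_ (Real.add_one_le_exp _)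
    have e1 : unif.real B * (∫ x, Real.exp (-t * (κ + τ * x)) ∂ν - 1) ≤
        (j : ℝ) / m * (Real.exp (-(t * κ / 2)) - 1) := by
      have h1 : Real.exp (-(t * κ / 2)) - 1 ≤ 0 := by
        rw [sub_nonpos, Real.exp_le_one_iff]
        have : 0 < t * κ := by positivity
        linarith
      refine (mul_le_mul_of_nonneg_left (sub_le_sub_right hφ 1) measureReal_nonneg).trans ?_
      exact mul_le_mul_of_nonpos_right hjB h1
    have e2 : unif.real R * D ≤ 1 / m * D := by gcongr
    rw [sub_div]
    calc _ ≤ 1 + (j : ℝ) / m * (Real.exp (-(t * κ / 2)) - 1) + 1 / m * D := by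
            rw [← hD]; linarith
      _ = _ := by ring

theorem unif_real_Ioc_of_mem {a b : ℝ} (ha : 0 ≤ a) (hb : b ≤ 1) (hab : a ≤ b) :
    unif.real (Ioc a b) = b - a := by
  rw [measureReal_def, unif, Measure.restrict_apply measurableSet_Ioc,
    inter_eq_left.2 fun x hx => mem_Icc.2 ⟨ha.trans hx.1.le, hx.2.trans hb⟩, Real.volume_Ioc,
    ENNReal.toReal_ofReal (by linarith)]

theorem unif_real_Ioc_le {a b : ℝ} (hab : a ≤ b) : unif.real (Ioc a b) ≤ b - a := by
  rw [measureReal_def, unif, Measure.restrict_apply measurableSet_Ioc]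
  refine ENNReal.toReal_le_of_le_ofReal (by linarith) ?_
  rw [← Real.volume_Ioc]
  exact measure_mono inter_subset_left

theorem exists_exceptional_bound {ν : Measure ℝ} [IsProbabilityMeasure ν]
    (hmean : ∫ x, x ∂ν = 0)
    (hmgf : ∀ᶠ t in 𝓝 (0 : ℝ), Integrable (fun x => Real.exp (t * x)) ν) {κ : ℝ} (hκ : 0 < κ)
    {τ : ℝ} (hτ : |τ| = 1) {δ : ℝ} (hδ : 0 < δ) :
    ∃ J : ℕ, ∀ m : ℕ, 0 < m → ∀ q : ℝ,
      sampleLaw ν m {p | (q, p) ∈ exceptional κ τ m J} ≤ ENNReal.ofReal δ := by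
  obtain ⟨a, ha, D, H⟩ := exists_excess_nonpos_bound hmean hmgf hκ
  set f : ℕ → ℝ := fun j => 2 * Real.exp (D - a * j) with hf
  have hfs : Summable f := by
    have h1 : f = fun j => (2 * Real.exp D) * Real.exp (-a) ^ j := by
      funext j
      rw [hf, ← Real.exp_nat_mul, mul_assoc, ← Real.exp_add]
      ring_nf
    rw [h1]
    exact (summable_geometric_of_lt_one (Real.exp_pos _).le
      (Real.exp_lt_one_iff.2 (by linarith))).mul_left _
  -- `J` comes from the tail of a series free of `m` and `q`, which gives the uniformity.
  obtain ⟨J, hJ⟩ := ((tendsto_sum_nat_add f).eventually (gt_mem_nhds hδ)).exists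
  refine ⟨J, fun m hm q => ?_⟩
  by_cases hq : q ∈ Icc (0 : ℝ) 1
  swap
  · rw [show {p | (q, p) ∈ exceptional κ τ m J} = ∅ from
      eq_empty_of_forall_notMem fun p hp => hq hp.1]
    simp
  have hm' : (0 : ℝ) < m := by positivity
  set M := sampleLaw ν m
  set E₁ : ℕ → Set ((Fin m → ℝ) × (Fin m → ℝ)) := fun j =>
    {p | q + j / m ≤ 1 ∧ excess κ τ (Ioc q (q + j / m))
      (Ioc (q + j / m) (q + (j + 1) / m)) p.1 p.2 ≤ 0}
  set E₂ : ℕ → Set ((Fin m → ℝ) × (Fin m → ℝ)) := fun j =>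
    {p | 0 ≤ q - j / m ∧ excess κ (-τ) (Ioc (q - j / m) q)
      (Ioc (q - (j + 1) / m) (q - j / m)) p.1 p.2 ≤ 0}
  have hE₁ : ∀ j, M.real (E₁ j) ≤ Real.exp (D - a * j) := by
    intro j
    have hj0 : (0 : ℝ) ≤ j / m := by positivity
    by_cases hj : q + j / m ≤ 1
    · refine le_trans (measureReal_mono fun p hp => hp.2) (H τ hτ m j _ _ hm measurableSet_Ioc
        measurableSet_Ioc (Ioc_disjoint_Ioc_of_le le_rfl) ?_ ?_)
      · rw [unif_real_Ioc_of_mem hq.1 hj (by linarith)]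
        linarith
      · have h1 : ((j : ℝ) + 1) / m = j / m + 1 / m := add_div _ _ _
        have h2 : (0 : ℝ) < 1 / m := by positivity
        refine (unif_real_Ioc_le (by linarith)).trans (by linarith)
    · rw [show E₁ j = ∅ from eq_empty_of_forall_notMem fun p hp => hj hp.1]
      simpa using (Real.exp_pos _).le
  have hE₂ : ∀ j, M.real (E₂ j) ≤ Real.exp (D - a * j) := by
    intro j
    have hj0 : (0 : ℝ) ≤ j / m := by positivity
    by_cases hj : 0 ≤ q - j / m
    · refine le_trans (measureReal_mono fun p hp => hp.2) (H (-τ) (by rwa [abs_neg]) m j _ _ hm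
        measurableSet_Ioc measurableSet_Ioc (Ioc_disjoint_Ioc_of_le le_rfl).symm ?_ ?_)
      · rw [unif_real_Ioc_of_mem hj hq.2 (by linarith)]
        linarith
      · have h1 : ((j : ℝ) + 1) / m = j / m + 1 / m := add_div _ _ _
        have h2 : (0 : ℝ) < 1 / m := by positivity
        refine (unif_real_Ioc_le (by linarith)).trans (by linarith)
    · rw [show E₂ j = ∅ from eq_empty_of_forall_notMem fun p hp => hj hp.1]
      simpa using (Real.exp_pos _).le
  have hsub : {p | (q, p) ∈ exceptional κ τ m J} ⊆ ⋃ k, (E₁ (k + J) ∪ E₂ (k + J)) := by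
    rintro p ⟨_, j, hj, h⟩
    refine mem_iUnion.2 ⟨j - J, ?_⟩
    rw [Nat.sub_add_cancel hj]
    exact h
  calc M {p | (q, p) ∈ exceptional κ τ m J}
      ≤ ∑' k, M (E₁ (k + J) ∪ E₂ (k + J)) := (measure_mono hsub).trans (measure_iUnion_le _)
    _ ≤ ∑' k, ENNReal.ofReal (f (k + J)) := by
        refine ENNReal.tsum_le_tsum fun k => ?_
        rw [← ofReal_measureReal]
        refine ENNReal.ofReal_le_ofReal ((measureReal_union_le _ _).trans ?_)
        linarith [hE₁ (k + J), hE₂ (k + J)]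
    _ = ENNReal.ofReal (∑' k, f (k + J)) :=
        (ENNReal.ofReal_tsum_of_nonneg (fun k => by positivity)
          ((summable_nat_add_iff J).2 hfs)).symm
    _ ≤ ENNReal.ofReal δ := ENNReal.ofReal_le_ofReal hJ.le

theorem measurable_excess {m : ℕ} (κ τ : ℝ) {l u l' u' : ℝ → ℝ} (hl : Measurable l)
    (hu : Measurable u) (hl' : Measurable l') (hu' : Measurable u') :
    Measurable fun p : ℝ × (Fin m → ℝ) × (Fin m → ℝ) =>
      excess κ τ (Ioc (l p.1) (u p.1)) (Ioc (l' p.1) (u' p.1)) p.2.1 p.2.2 := by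
  have hind : ∀ (i : Fin m) {l u : ℝ → ℝ} (f : ℝ × (Fin m → ℝ) × (Fin m → ℝ) → ℝ), Measurable l →
      Measurable u → Measurable f → Measurable fun p : ℝ × (Fin m → ℝ) × (Fin m → ℝ) =>
        (Ioc (l p.1) (u p.1)).indicator (fun _ => f p) (p.2.1 i) := by
    intro i l u f hl hu hf
    simp only [indicator]
    have h1 : MeasurableSet {p : ℝ × (Fin m → ℝ) × (Fin m → ℝ) | l p.1 < p.2.1 i} :=
      measurableSet_lt (by fun_prop) (by fun_prop)
    have h2 : MeasurableSet {p : ℝ × (Fin m → ℝ) × (Fin m → ℝ) | p.2.1 i ≤ u p.1} :=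
      measurableSet_le (by fun_prop) (by fun_prop)
    exact Measurable.ite (h1.inter h2) hf measurable_const
  exact Finset.measurable_fun_sum _ fun i _ => (hind i (fun p => κ + τ * p.2.2 i) hl hu
    (by fun_prop)).sub (hind i (fun p => |p.2.2 i|) hl' hu' (by fun_prop))

/-- Joint measurability in `q` and the sample is needed for Fubini when `q` is random. -/
theorem measurableSet_exceptional (κ τ : ℝ) (m J : ℕ) :
    MeasurableSet (exceptional κ τ m J) := by
  have h : exceptional κ τ m J = {p | p.1 ∈ Icc (0 : ℝ) 1} ∩ ⋃ j : ℕ, ⋃ (_ : J ≤ j),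
    (({p | p.1 + (j : ℝ) / m ≤ 1} ∩ {p | excess κ τ (Ioc p.1 (p.1 + j / m))
        (Ioc (p.1 + j / m) (p.1 + (j + 1) / m)) p.2.1 p.2.2 ≤ 0}) ∪
      ({p | 0 ≤ p.1 - (j : ℝ) / m} ∩ {p | excess κ (-τ) (Ioc (p.1 - j / m) p.1)
        (Ioc (p.1 - (j + 1) / m) (p.1 - j / m)) p.2.1 p.2.2 ≤ 0})) := by
    ext p
    simp only [exceptional, mem_ofPred_eq, mem_inter_iff, mem_iUnion, mem_union, exists_prop]
  rw [h]
  have h1 (j : ℕ) := measurable_excess (m := m) κ τ (l := fun q => q) (u := fun q => q + j / m)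
    (l' := fun q => q + j / m) (u' := fun q => q + (j + 1) / m) (by fun_prop) (by fun_prop)
    (by fun_prop) (by fun_prop)
  have h2 (j : ℕ) := measurable_excess (m := m) κ (-τ) (l := fun q => q - j / m) (u := fun q => q)
    (l' := fun q => q - (j + 1) / m) (u' := fun q => q - j / m) (by fun_prop) (by fun_prop)
    (by fun_prop) (by fun_prop)
  exact (measurable_fst measurableSet_Icc).inter (MeasurableSet.iUnion fun j =>
    MeasurableSet.iUnion fun _ => ((measurableSet_le (by fun_prop) measurable_const).inter
      (measurableSet_le (h1 j) measurable_const)).union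
    ((measurableSet_le measurable_const (by fun_prop)).inter
      (measurableSet_le (h2 j) measurable_const)))

/-! ### The first stage: sample counts and error sums -/

theorem exists_count_bound {ν : Measure ℝ} [IsProbabilityMeasure ν] {B : Set ℝ}
    (hB : MeasurableSet B) (hpos : 0 < unif.real B) :
    ∃ c > 0, ∀ c' ≤ c, ∀ m : ℕ, (sampleLaw ν m).real
      {p | ¬ c' * m ≤ ∑ i, B.indicator (1 : ℝ → ℝ) (p.1 i)} ≤ Real.exp (-c) ^ m := by
  -- With this `c`, the moment of `exp (-1_B)` is `1 - 2 * c ≤ exp (-2 * c)`; centring by `c` costs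
  -- a factor `exp c`.
  set c := unif.real B * (1 - Real.exp (-1)) / 2 with hc
  have he : 0 < 1 - Real.exp (-1) := sub_pos.2 (Real.exp_lt_one_iff.2 (by norm_num))
  have hc0 : 0 < c := by positivity
  refine ⟨c, hc0, fun c' hc' m => ?_⟩
  have hIB : Integrable (B.indicator (1 : ℝ → ℝ)) unif := (integrable_indicator_iff hB).2
    (integrable_const (1 : ℝ)).integrableOn
  have hI : Integrable (fun p : ℝ × ℝ => B.indicator (1 : ℝ → ℝ) p.1 * (Real.exp (-1) - 1))
    (unif.prod ν) := hIB.mul_prod (integrable_const (Real.exp (-1) - 1))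
  have key : (fun p : ℝ × ℝ => Real.exp (-1 * (B.indicator (1 : ℝ → ℝ) p.1 - c))) = fun p =>
      Real.exp c * (1 + B.indicator (1 : ℝ → ℝ) p.1 * (Real.exp (-1) - 1)) := by
    funext p
    by_cases hb : p.1 ∈ B
    · simp only [hb, indicator_of_mem, Pi.one_apply]
      rw [one_mul, add_sub_cancel, ← Real.exp_add]
      ring_nf
    · simp [hb]
  have h := sampleLaw_sum_nonpos_le (ν := ν) (g := fun p => B.indicator (1 : ℝ → ℝ) p.1 - c)
    (((measurable_one.indicator hB).comp measurable_fst).sub_const c) zero_le_one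
    (by rw [key]; exact ((integrable_const 1).add hI).const_mul _) (b := Real.exp (-c)) (by
      have e := integral_prod_mul (μ := unif) (ν := ν) (B.indicator (1 : ℝ → ℝ))
        (fun _ => Real.exp (-1) - 1)
      rw [integral_indicator_one hB] at e
      rw [key, integral_const_mul, integral_add (integrable_const 1) hI, e]
      simp only [integral_const, probReal_univ, smul_eq_mul, one_mul]
      have h1 : 1 + unif.real B * (Real.exp (-1) - 1) ≤ Real.exp (-(2 * c)) := by
        refine le_trans (le_of_eq ?_) (Real.add_one_le_exp _)
        rw [hc]; ring
      refine (mul_le_mul_of_nonneg_left h1 (Real.exp_pos _).le).trans ?_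
      rw [← Real.exp_add, Real.exp_le_exp]
      linarith) m
  refine le_trans (measureReal_mono fun p hp => ?_) h
  simp only [mem_ofPred_eq, not_le, Finset.sum_sub_distrib, Finset.sum_const, Finset.card_univ,
    Fintype.card_fin, nsmul_eq_mul] at hp ⊢
  have : c' * m ≤ c * m := by gcongr
  linarith

/-- Samples for which some error sum over an order interval of the covariates is large. -/
def noisy (b : ℝ) (m : ℕ) : Set ((Fin m → ℝ) × (Fin m → ℝ)) :=
  {p | ∃ i j, b * (between p.1 i j).card < (∑ k ∈ between p.1 i j, p.2 k) ^ 2}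

/-- With `k = S.card`, the threshold `r = √(η * m * k)` dominates both `√η * k`, which absorbs the
quadratic term of the Chernoff exponent, and `√η * √m`, which gives the rate. -/
theorem exists_sum_sq_bound {ν : Measure ℝ} [IsProbabilityMeasure ν]
    (hmean : ∫ x, x ∂ν = 0)
    (hmgf : ∀ᶠ t in 𝓝 (0 : ℝ), Integrable (fun x => Real.exp (t * x)) ν) {η : ℝ} (hη : 0 < η) :
    ∃ c > 0, ∀ (m : ℕ) (S : Finset (Fin m)), (Measure.pi fun _ : Fin m => ν).real
      {e | η * m * S.card < (∑ k ∈ S, e k) ^ 2} ≤ 2 * Real.exp (-(c * √m)) := by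
  obtain ⟨s, hs, C, hC, -, hsbd⟩ := exists_mgf_bound hmean hmgf
  set t := min s (√η / (2 * C)) with ht
  have hη' : 0 < √η := Real.sqrt_pos.2 hη
  have ht0 : 0 < t := lt_min hs (by positivity)
  have hts : t ≤ s := min_le_left _ _
  have htC : C * t ≤ √η / 2 := by
    have : t ≤ √η / (2 * C) := min_le_right _ _
    rw [le_div_iff₀ (by positivity)] at this
    linarith
  refine ⟨t * √η / 2, by positivity, fun m S => ?_⟩
  rcases S.eq_empty_or_nonempty with rfl | hne
  · simp only [Finset.card_empty, Nat.cast_zero, mul_zero, Finset.sum_empty, ne_eq,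
      OfNat.ofNat_ne_zero, not_false_eq_true, zero_pow, lt_irrefl]
    simpa using (Real.exp_pos _).le
  set M := Measure.pi fun _ : Fin m => ν with hM
  have hk1 : (1 : ℝ) ≤ S.card := by exact_mod_cast hne.card_pos
  have hkm : (S.card : ℝ) ≤ m := by exact_mod_cast (Finset.card_le_univ S).trans (by simp)
  set k := (S.card : ℝ) with hk
  set r := √(η * m * k) with hr
  have hr1 : √η * √m ≤ r := by
    rw [← Real.sqrt_mul hη.le]
    exact Real.sqrt_le_sqrt (le_mul_of_one_le_right (by positivity) hk1)
  have hr2 : √η * k ≤ r := by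
    refine Real.le_sqrt_of_sq_le ?_
    rw [mul_pow, Real.sq_sqrt hη.le]
    nlinarith [mul_le_mul_of_nonneg_right hkm (by positivity : 0 ≤ k)]
  have tail : ∀ τ : ℝ, |τ| = 1 → M.real {e | r ≤ ∑ k ∈ S, τ * e k} ≤
      Real.exp (-(t * √η / 2 * √m)) := by
    intro τ hτ
    have hmp : ∀ i : Fin m, MeasurePreserving (Function.eval i) M ν := fun i =>
      measurePreserving_eval (fun _ : Fin m => ν) i
    have hind : iIndepFun (fun (i : Fin m) (e : Fin m → ℝ) => τ * e i) M :=
      iIndepFun_pi (X := fun _ x => τ * x) fun _ => by fun_prop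
    have hmeas : ∀ i : Fin m, Measurable fun e : Fin m → ℝ => τ * e i := fun i => by fun_prop
    have htτ : |t * τ| ≤ s := by rw [abs_mul, hτ, abs_of_pos ht0, mul_one]; exact hts
    obtain ⟨hi, hle⟩ := hsbd _ htτ
    have hint : ∀ i : Fin m, Integrable (fun e : Fin m → ℝ => Real.exp (t * (τ * e i))) M :=
      fun i => by
        simp only [← mul_assoc]
        exact (hmp i).integrable_comp_of_integrable hi
    have hmgf' : ∀ i : Fin m, mgf (fun e : Fin m → ℝ => τ * e i) M t ≤ Real.exp (C * t ^ 2) := by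
      intro i
      have h1 : (t * τ) ^ 2 = t ^ 2 := by rw [mul_pow, ← sq_abs τ, hτ]; ring
      rw [h1, ← (hmp i).map_eq, integral_map (hmp i).measurable.aemeasurable (by fun_prop)] at hle
      simpa only [mgf, ← mul_assoc] using hle
    have h := measure_ge_le_exp_mul_mgf (μ := M) (X := ∑ i ∈ S, fun e : Fin m → ℝ => τ * e i) r
      ht0.le (hind.integrable_exp_mul_sum hmeas fun i _ => hint i)
    rw [hind.mgf_sum hmeas] at h
    simp only [Finset.sum_apply] at h
    refine h.trans ?_
    have h2 : ∏ i ∈ S, mgf (fun e : Fin m → ℝ => τ * e i) M t ≤ Real.exp (k * (C * t ^ 2)) := by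
      rw [hk, Real.exp_nat_mul]
      exact (Finset.prod_le_prod (fun i _ => mgf_nonneg) fun i _ => hmgf' i).trans
        (by rw [Finset.prod_const])
    refine (mul_le_mul_of_nonneg_left h2 (Real.exp_pos _).le).trans ?_
    rw [← Real.exp_add, Real.exp_le_exp]
    have h3 : k * (C * t ^ 2) ≤ t * r / 2 := by
      calc k * (C * t ^ 2) = (C * t) * (t * k) := by ring
        _ ≤ (√η / 2) * (t * k) := by gcongr
        _ = t * (√η * k) / 2 := by ring
        _ ≤ _ := by gcongr
    have h4 : t * (√η * √m) ≤ t * r := by gcongr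
    linarith
  have hsub : {e : Fin m → ℝ | η * m * k < (∑ k ∈ S, e k) ^ 2} ⊆
      {e | r ≤ ∑ k ∈ S, 1 * e k} ∪ {e | r ≤ ∑ k ∈ S, -1 * e k} := by
    intro e he
    have h1 : r ≤ |∑ k ∈ S, e k| := by
      rw [← Real.sqrt_sq_eq_abs]
      exact Real.sqrt_le_sqrt (le_of_lt he)
    rcases le_abs.1 h1 with h | h
    · left; simpa using h
    · right; simpa [Finset.sum_neg_distrib] using h
  refine (measureReal_mono hsub).trans ((measureReal_union_le _ _).trans ?_)
  linarith [tail 1 (by simp), tail (-1) (by simp)]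

theorem measurableSet_noisy_pair (b : ℝ) {m : ℕ} (i j : Fin m) :
    MeasurableSet {p : (Fin m → ℝ) × (Fin m → ℝ) |
      b * (between p.1 i j).card < (∑ k ∈ between p.1 i j, p.2 k) ^ 2} := by
  have hS : ∀ k, MeasurableSet {p : (Fin m → ℝ) × (Fin m → ℝ) |
      p.1 i ≤ p.1 k ∧ p.1 k ≤ p.1 j} := fun k => by
    have h1 : MeasurableSet {p : (Fin m → ℝ) × (Fin m → ℝ) | p.1 i ≤ p.1 k} :=
      measurableSet_le (by fun_prop) (by fun_prop)
    have h2 : MeasurableSet {p : (Fin m → ℝ) × (Fin m → ℝ) | p.1 k ≤ p.1 j} :=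
      measurableSet_le (by fun_prop) (by fun_prop)
    exact h1.inter h2
  have hsum : ∀ f : Fin m → (Fin m → ℝ) × (Fin m → ℝ) → ℝ, (∀ k, Measurable (f k)) →
      Measurable fun p : (Fin m → ℝ) × (Fin m → ℝ) => ∑ k ∈ between p.1 i j, f k p := by
    intro f hf
    simp only [between, Finset.sum_filter]
    exact Finset.measurable_fun_sum _ fun k _ => Measurable.ite (hS k) (hf k) measurable_const
  simp only [Finset.cast_card]
  exact measurableSet_lt ((hsum (fun _ _ => 1) fun _ => measurable_const).const_mul b)
    ((hsum (fun k p => p.2 k) fun k => by fun_prop).pow_const 2)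

theorem tendsto_noisy {ν : Measure ℝ} [IsProbabilityMeasure ν]
    (hmean : ∫ x, x ∂ν = 0)
    (hmgf : ∀ᶠ t in 𝓝 (0 : ℝ), Integrable (fun x => Real.exp (t * x)) ν) {η : ℝ} (hη : 0 < η) :
    Tendsto (fun m : ℕ => (sampleLaw ν m).real (noisy (η * m) m)) atTop (𝓝 0) := by
  obtain ⟨c, hc, H⟩ := exists_sum_sq_bound hmean hmgf hη
  have hpair : ∀ (m : ℕ) (i j : Fin m), (sampleLaw ν m).real
      {p | η * m * (between p.1 i j).card < (∑ k ∈ between p.1 i j, p.2 k) ^ 2} ≤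
      2 * Real.exp (-(c * √m)) := by
    intro m i j
    refine ENNReal.toReal_le_of_le_ofReal (by positivity) ?_
    -- Given the covariates, the index set is fixed and only the errors are random.
    rw [sampleLaw, Measure.prod_apply (measurableSet_noisy_pair _ i j)]
    refine (lintegral_mono (g := fun _ => ENNReal.ofReal (2 * Real.exp (-(c * √m))))
      fun x => ?_).trans (by simp)
    rw [← ofReal_measureReal]
    exact ENNReal.ofReal_le_ofReal (H m (between x i j))
  have hbd : ∀ m : ℕ, (sampleLaw ν m).real (noisy (η * m) m) ≤
      m * (m * (2 * Real.exp (-(c * √m)))) := by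
    intro m
    have h : noisy (η * m) m = ⋃ i, ⋃ j,
      {p | η * m * (between p.1 i j).card < (∑ k ∈ between p.1 i j, p.2 k) ^ 2} := by
      ext p; simp [noisy]
    rw [h]
    refine (measureReal_iUnion_fintype_le _).trans ?_
    refine (Finset.sum_le_card_nsmul _ _ (m * (2 * Real.exp (-(c * √m)))) fun i _ => ?_).trans
      (by simp)
    refine (measureReal_iUnion_fintype_le _).trans ?_
    exact (Finset.sum_le_card_nsmul _ _ _ fun j _ => hpair m i j).trans (by simp)
  refine squeeze_zero (fun _ => measureReal_nonneg) hbd ?_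
  have h1 : Tendsto (fun m : ℕ => c * √(m : ℝ)) atTop atTop :=
    (Real.tendsto_sqrt_atTop.comp tendsto_natCast_atTop_atTop).const_mul_atTop hc
  -- With `y = c * √m`, the union bound `2 * m ^ 2 * exp (-y)` equals `(2 / c ^ 4) * y ^ 4 * exp
  -- (-y)`.
  have h2 := ((Real.tendsto_pow_mul_exp_neg_atTop_nhds_zero 4).comp h1).const_mul (2 / c ^ 4)
  rw [mul_zero] at h2
  refine h2.congr fun m => ?_
  have h3 : √(m : ℝ) ^ 4 = m * m := by
    rw [show 4 = 2 * 2 by norm_num, pow_mul, Real.sq_sqrt (by positivity), sq]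
  simp only [Function.comp, mul_pow, h3]
  field_simp

/-- With high probability, least-squares minimizers have levels close to the true ones and a
change point within `O(1 / m)` of the true one. -/
theorem exists_first_stage_bound {ν : Measure ℝ} [IsProbabilityMeasure ν]
    (hmean : ∫ x, x ∂ν = 0)
    (hmgf : ∀ᶠ t in 𝓝 (0 : ℝ), Integrable (fun x => Real.exp (t * x)) ν)
    {α₀ β₀ d₀ : ℝ} (hαβ : α₀ ≠ β₀) (hd₀ : d₀ ∈ Ioo (0 : ℝ) 1) {δ : ℝ} (hδ : 0 < δ) :
    ∃ J : ℕ, ∀ᶠ m : ℕ in atTop, ∃ N : Set ((Fin m → ℝ) × (Fin m → ℝ)),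
      sampleLaw ν m N ≤ ENNReal.ofReal δ ∧ ∀ x e, (x, e) ∉ N → ∀ α β d,
        IsLSMinimizer x (responses α₀ β₀ d₀ x e) α β d →
          |α - α₀| ≤ |β₀ - α₀| / 8 ∧ |β - β₀| ≤ |β₀ - α₀| / 8 ∧ |d - d₀| ≤ J / m := by
  have hΔ : β₀ - α₀ ≠ 0 := sub_ne_zero.2 hαβ.symm
  have hΔ' : 0 < |β₀ - α₀| := abs_pos.2 hΔ
  set τ := (SignType.sign (β₀ - α₀) : ℝ) with hτ
  have hτ1 : |τ| = 1 := by
    rcases lt_or_gt_of_ne hΔ with h | h <;> simp [hτ, h]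
  have hδ4 : 0 < δ / 4 := by positivity
  obtain ⟨J, hJ⟩ := exists_exceptional_bound hmean hmgf
    (by positivity : 0 < 3 * |β₀ - α₀| / 8) hτ1 hδ4
  have hl0 : unif.real (Ioc 0 d₀) = d₀ - 0 := unif_real_Ioc_of_mem le_rfl hd₀.2.le hd₀.1.le
  have hr0 : unif.real (Ioc d₀ 1) = 1 - d₀ := unif_real_Ioc_of_mem hd₀.1.le le_rfl hd₀.2.le
  obtain ⟨c₁, hc₁, H₁⟩ := exists_count_bound (ν := ν) (measurableSet_Ioc (a := 0) (b := d₀))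
    (by rw [hl0]; linarith [hd₀.1])
  obtain ⟨c₂, hc₂, H₂⟩ := exists_count_bound (ν := ν) (measurableSet_Ioc (a := d₀) (b := 1))
    (by rw [hr0]; linarith [hd₀.2])
  set c := min c₁ c₂ with hc
  have hc0 : 0 < c := lt_min hc₁ hc₂
  have hsq : 0 < (β₀ - α₀) ^ 2 := by positivity
  have hpow : ∀ {a : ℝ}, 0 < a → ∀ᶠ m : ℕ in atTop, Real.exp (-a) ^ m < δ / 4 := fun ha =>
    (tendsto_pow_atTop_nhds_zero_of_lt_one (Real.exp_pos _).le
      (Real.exp_lt_one_iff.2 (by linarith))).eventually (gt_mem_nhds hδ4)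
  refine ⟨J, ?_⟩
  filter_upwards [(tendsto_noisy hmean hmgf (by positivity :
    0 < c * (β₀ - α₀) ^ 2 / 2000)).eventually (gt_mem_nhds hδ4), hpow hc₁, hpow hc₂,
    eventually_gt_atTop 0] with m h1 h2 h3 hm
  set N₀ := noisy (c * (β₀ - α₀) ^ 2 / 2000 * m) m
  set N₁ := {p : (Fin m → ℝ) × (Fin m → ℝ) |
    ¬ c * m ≤ ∑ i, (Ioc 0 d₀).indicator (1 : ℝ → ℝ) (p.1 i)}
  set N₂ := {p : (Fin m → ℝ) × (Fin m → ℝ) |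
    ¬ c * m ≤ ∑ i, (Ioc d₀ 1).indicator (1 : ℝ → ℝ) (p.1 i)}
  set N₃ := {p : (Fin m → ℝ) × (Fin m → ℝ) |
    (d₀, p) ∈ exceptional (3 * |β₀ - α₀| / 8) τ m J}
  refine ⟨N₀ ∪ N₁ ∪ N₂ ∪ N₃, ?_, ?_⟩
  · have g1 := (H₁ c (min_le_left _ _) m).trans h2.le
    have g2 := (H₂ c (min_le_right _ _) m).trans h3.le
    have g3 : (sampleLaw ν m).real N₃ ≤ δ / 4 := ENNReal.toReal_le_of_le_ofReal hδ4.le (hJ m hm d₀)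
    rw [← ofReal_measureReal]
    refine ENNReal.ofReal_le_ofReal ?_
    have u1 := measureReal_union_le (μ := sampleLaw ν m) (N₀ ∪ N₁ ∪ N₂) N₃
    have u2 := measureReal_union_le (μ := sampleLaw ν m) (N₀ ∪ N₁) N₂
    have u3 := measureReal_union_le (μ := sampleLaw ν m) N₀ N₁
    linarith
  · intro x e hN α β d hmin
    simp only [mem_union, not_or] at hN
    obtain ⟨⟨⟨hN0, hN1⟩, hN2⟩, hN3⟩ := hN
    have hcount : ∀ {B : Set ℝ} {S : Finset (Fin m)}, (∀ i, x i ∈ B → i ∈ S) →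
        ∑ i, B.indicator (1 : ℝ → ℝ) (x i) ≤ S.card := by
      intro B S hBS
      calc ∑ i, B.indicator (1 : ℝ → ℝ) (x i) ≤ ∑ i, if i ∈ S then (1 : ℝ) else 0 := by
            refine Finset.sum_le_sum fun i _ => ?_
            by_cases h : x i ∈ B
            · simp [h, hBS i h]
            · rw [indicator_of_notMem h]; split_ifs <;> norm_num
        _ = S.card := by simp
    have hclose : ∀ r > 0, |α - α₀| ≤ |β₀ - α₀| / 8 ∧ |β - β₀| ≤ |β₀ - α₀| / 8 ∧
        |d - d₀| ≤ J / m + r := by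
      intro r hr
      obtain ⟨z, hz, hz1, hz2, hz3⟩ := hmin.exists_near hr
      have hd₀' : d₀ ∈ Icc (0 : ℝ) 1 := ⟨hd₀.1.le, hd₀.2.le⟩
      obtain ⟨hα, hβ⟩ := levels_close hm hc0 hαβ (fun i j => not_lt.1 fun h => hN0 ⟨i, j, h⟩)
        ((not_not.1 hN1).trans (hcount fun i hi => by simpa using hi.2))
        ((not_not.1 hN2).trans (hcount fun i hi => by simpa using hi.1)) (hz3 α₀ β₀ d₀ hd₀')
      have hzd := abs_sub_le_of_notMem_exceptional hm hτ hαβ hα hβ hd₀' hz hN3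
        (hz3 α β d₀ hd₀')
      refine ⟨hα, hβ, ?_⟩
      have := abs_sub_le d z d₀
      have : |d - z| ≤ r := abs_le.2 ⟨by linarith, by linarith⟩
      linarith
    exact ⟨(hclose 1 one_pos).1, (hclose 1 one_pos).2.1,
      le_of_forall_pos_le_add fun r hr => (hclose r hr).2.2⟩

/-! ### Second-stage localization in the original scale -/

theorem abs_sub_le_of_mem_secondStageMinimizers {m J : ℕ} (hm : 0 < m) {v e : Fin m → ℝ}
    {α₀ β₀ d₀ α β τ c h d : ℝ} (hh : 0 < h) (hτ : τ = SignType.sign (β₀ - α₀)) (hαβ : α₀ ≠ β₀)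
    (hα : |α - α₀| ≤ |β₀ - α₀| / 8) (hβ : |β - β₀| ≤ |β₀ - α₀| / 8) (hc : |c - d₀| ≤ h)
    (hv : ((d₀ - c + h) / (2 * h), v, e) ∉ exceptional (3 * |β₀ - α₀| / 8) τ m J)
    (hd : d ∈ secondStageMinimizers (rescale c h v) (responses α₀ β₀ d₀ (rescale c h v) e)
      α β c h) :
    |d - d₀| ≤ 2 * h * (J / m) := by
  have hunit : ∀ t ∈ Icc (c - h) (c + h), (t - c + h) / (2 * h) ∈ Icc (0 : ℝ) 1 := fun t ht =>
    ⟨div_nonneg (by linarith [ht.1]) (by positivity),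
      (div_le_one (by positivity)).2 (by linarith [ht.2])⟩
  have hc' := abs_le.1 hc
  have hd₀ : d₀ ∈ Icc (c - h) (c + h) := ⟨by linarith, by linarith⟩
  refine le_of_forall_pos_le_add fun r hr => ?_
  obtain ⟨t, ht, ht1, ht2, ht3⟩ := IsMinimizerOn.exists_near hd hr
  have hcrit := ht3 d₀ hd₀
  rw [responses_rescale hh, lsCriterion_rescale hh, lsCriterion_rescale hh] at hcrit
  have key := abs_sub_le_of_notMem_exceptional hm hτ hαβ hα hβ (hunit d₀ hd₀) (hunit t ht) hv hcrit
  have h1 : t - d₀ = 2 * h * ((t - c + h) / (2 * h) - (d₀ - c + h) / (2 * h)) := by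
    field_simp; ring
  have h2 : |t - d₀| ≤ 2 * h * (J / m) := by
    rw [h1, abs_mul, abs_of_pos (by positivity : 0 < 2 * h)]
    gcongr
  have h3 : |d - t| ≤ r := abs_le.2 ⟨by linarith, by linarith⟩
  linarith [abs_sub_le d t d₀]

/-! ### Joint law of the two stages -/

theorem IsTwoStageExperiment.aemeasurable_map_eq {Ω : Type*} [MeasurableSpace Ω] {P : Measure Ω}
    [IsProbabilityMeasure P] {ν : Measure ℝ} [IsProbabilityMeasure ν] {n₁ n₂ : ℕ}
    {X ε : Fin n₁ → Ω → ℝ} {V η : Fin n₂ → Ω → ℝ} (h : IsTwoStageExperiment P ν X ε V η) :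
    AEMeasurable (fun ω => ((fun i => X i ω, fun i => ε i ω), (fun j => V j ω, fun j => η j ω))) P ∧
    P.map (fun ω => ((fun i => X i ω, fun i => ε i ω), (fun j => V j ω, fun j => η j ω))) =
      (sampleLaw ν n₁).prod (sampleLaw ν n₂) := by
  set Z := Sum.elim (Sum.elim X ε) (Sum.elim V η) with hZ
  set μ : (Fin n₁ ⊕ Fin n₁) ⊕ (Fin n₂ ⊕ Fin n₂) → Measure ℝ :=
    Sum.elim (Sum.elim (fun _ => unif) fun _ => ν) (Sum.elim (fun _ => unif) fun _ => ν) with hμ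
  have hlaw : ∀ i, HasLaw (Z i) (μ i) P := by
    rintro ((i | i) | (i | i))
    exacts [h.law_X i, h.law_ε i, h.law_V i, h.law_η i]
  have : ∀ i, IsProbabilityMeasure (μ i) := by
    rintro ((i | i) | (i | i)) <;> simp only [hμ, Sum.elim_inl, Sum.elim_inr] <;> infer_instance
  have hZm : AEMeasurable (fun ω i => Z i ω) P := aemeasurable_pi_iff.2 fun i =>
    (hlaw i).aemeasurable
  have hmap := h.indep.map_fun_eq_pi_map fun i => (hlaw i).aemeasurable
  simp only [fun i => (hlaw i).map_eq] at hmap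
  have hφ := (((measurePreserving_sumPiEquivProdPi fun i => μ (.inl i)).prod
    (measurePreserving_sumPiEquivProdPi fun i => μ (.inr i)))).comp
    (measurePreserving_sumPiEquivProdPi μ)
  refine ⟨hφ.measurable.comp_aemeasurable hZm, ?_⟩
  have h1 := hφ.map_eq
  rw [← hmap, AEMeasurable.map_map_of_aemeasurable hφ.measurable.aemeasurable hZm] at h1
  exact h1

theorem measurable_responses {m : ℕ} (α β d : ℝ) :
    Measurable fun p : (Fin m → ℝ) × (Fin m → ℝ) => responses α β d p.1 p.2 := by
  refine measurable_pi_lambda _ fun i => ?_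
  simp only [responses, stump]
  exact (Measurable.ite (measurableSet_le (by fun_prop) measurable_const) measurable_const
    measurable_const).add (by fun_prop)

/-- If the second sample is, given the first one, exceptional with probability at most `δ`, then
the joint probability of this event is at most `δ`. -/
theorem IsTwoStageExperiment.measure_exceptional_le {Ω : Type*} [MeasurableSpace Ω] {P : Measure Ω}
    [IsProbabilityMeasure P] {ν : Measure ℝ} [IsProbabilityMeasure ν] {n₁ n₂ : ℕ}
    {X ε : Fin n₁ → Ω → ℝ} {V η : Fin n₂ → Ω → ℝ} (h : IsTwoStageExperiment P ν X ε V η)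
    {Q : (Fin n₁ → ℝ) × (Fin n₁ → ℝ) → ℝ} (hQ : Measurable Q) {κ τ : ℝ} {J : ℕ} {δ : ENNReal}
    (hδ : ∀ q, sampleLaw ν n₂ {p | (q, p) ∈ exceptional κ τ n₂ J} ≤ δ) :
    P {ω | (Q (fun i => X i ω, fun i => ε i ω), fun j => V j ω, fun j => η j ω) ∈
      exceptional κ τ n₂ J} ≤ δ := by
  obtain ⟨hm, hmap⟩ := h.aemeasurable_map_eq
  have hS := measurableSet_exceptional κ τ n₂ J
  have hQ' : Measurable fun p : ((Fin n₁ → ℝ) × (Fin n₁ → ℝ)) × ((Fin n₂ → ℝ) × (Fin n₂ → ℝ)) =>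
      (Q p.1, p.2) := by fun_prop
  refine (Measure.le_map_apply hm ((fun p => (Q p.1, p.2)) ⁻¹' exceptional κ τ n₂ J)).trans ?_
  rw [hmap, Measure.prod_apply (hQ' hS)]
  exact (lintegral_mono (g := fun _ => δ) fun p => hδ (Q p)).trans (by simp)

theorem IsTwoStageExperiment.measure_first_stage_le {Ω : Type*} [MeasurableSpace Ω] {P : Measure Ω}
    [IsProbabilityMeasure P] {ν : Measure ℝ} [IsProbabilityMeasure ν] {n₁ n₂ : ℕ}
    {X ε : Fin n₁ → Ω → ℝ} {V η : Fin n₂ → Ω → ℝ} (h : IsTwoStageExperiment P ν X ε V η)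
    (N : Set ((Fin n₁ → ℝ) × (Fin n₁ → ℝ))) :
    P {ω | (fun i => X i ω, fun i => ε i ω) ∈ N} ≤ sampleLaw ν n₁ N := by
  obtain ⟨hm, hmap⟩ := h.aemeasurable_map_eq
  -- `N` need not be measurable: the bound by the image measure and the product formula hold for all
  -- sets.
  refine (Measure.le_map_apply hm (N ×ˢ univ)).trans' (measure_mono fun ω hω => ⟨hω, trivial⟩)
    |>.trans ?_
  rw [hmap, Measure.prod_prod]
  simp

/-! ### Sample sizes and rates -/

theorem tendsto_atTop_of_ratio {k : ℕ → ℕ} {l : ℝ} (hl : 0 < l)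
    (h : Tendsto (fun n => (k n : ℝ) / n) atTop (𝓝 l)) :
    Tendsto k atTop atTop ∧ ∀ᶠ n : ℕ in atTop, l / 2 * n ≤ k n := by
  have h1 : ∀ᶠ n : ℕ in atTop, l / 2 * n ≤ k n := by
    filter_upwards [h.eventually (lt_mem_nhds (half_lt_self hl)), eventually_gt_atTop 0] with n hn h0
    exact ((lt_div_iff₀ (by positivity)).1 hn).le
  refine ⟨tendsto_natCast_atTop_iff.1 (tendsto_atTop_mono' atTop h1 ?_), h1⟩
  exact tendsto_natCast_atTop_atTop.const_mul_atTop (by positivity)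

/-- This is where `γ < 1` matters: the first-stage error is eventually smaller than the window. -/
theorem eventually_div_le_halfLength {K γ : ℝ} (hK : 0 < K) (hγ : γ < 1) (J : ℝ) :
    ∀ᶠ m : ℕ in atTop, J / m ≤ halfLength K γ m := by
  have h1 : Tendsto (fun m : ℕ => K * (m : ℝ) ^ (1 - γ)) atTop atTop :=
    ((tendsto_rpow_atTop (by linarith)).comp tendsto_natCast_atTop_atTop).const_mul_atTop hK
  filter_upwards [h1.eventually_ge_atTop J, eventually_gt_atTop 0] with m hm h0
  have h0' : (0 : ℝ) < m := by positivity
  rw [div_le_iff₀ h0', halfLength, mul_assoc, ← Real.rpow_add_one h0'.ne']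
  rwa [neg_add_eq_sub]

theorem rescaled_halfLength_le {K γ l l' J n : ℝ} {k k' : ℕ} (hK : 0 < K) (hγ : 0 < γ)
    (hl : 0 < l) (hl' : 0 < l') (hJ : 0 ≤ J) (hn : 0 < n) (hk : l * n ≤ k) (hk' : l' * n ≤ k') :
    n ^ (1 + γ) * (2 * halfLength K γ k * (J / k')) ≤ 2 * K * J * l ^ (-γ) / l' := by
  have h1 : (k : ℝ) ^ (-γ) ≤ (l * n) ^ (-γ) :=
    Real.rpow_le_rpow_of_nonpos (by positivity) hk (by linarith)
  have h2 : J / k' ≤ J / (l' * n) := by gcongr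
  have h3 : (0 : ℝ) ≤ (k : ℝ) ^ (-γ) := by positivity
  have h4 : 0 ≤ J / k' := by positivity
  calc n ^ (1 + γ) * (2 * halfLength K γ k * (J / k'))
      ≤ n ^ (1 + γ) * (2 * (K * (l * n) ^ (-γ)) * (J / (l' * n))) := by
        rw [halfLength]; gcongr
    _ = 2 * K * J * l ^ (-γ) / l' := by
        rw [Real.mul_rpow hl.le hn.le, Real.rpow_add hn, Real.rpow_one, Real.rpow_neg hn.le]
        have : n ^ γ ≠ 0 := (Real.rpow_pos_of_pos hn γ).ne'
        field_simp

end ChangePoint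

/-! ### Assembly of the two stages -/

theorem theorem1 {Ω : Type*} [MeasurableSpace Ω] (P : Measure Ω) [IsProbabilityMeasure P]
    -- the regression function and the error law
    (α₀ β₀ d₀ : ℝ) (hαβ : α₀ ≠ β₀) (hd₀ : d₀ ∈ Ioo (0 : ℝ) 1)
    (ν : Measure ℝ) [IsProbabilityMeasure ν] (hmean : ∫ x, x ∂ν = 0)
    (hmgf : ∀ᶠ t in 𝓝 (0 : ℝ), Integrable (fun x => Real.exp (t * x)) ν)
    -- the design constants and the sample sizes of the two stages
    (lam γ K : ℝ) (hlam : lam ∈ Ioo (0 : ℝ) 1) (hγ : γ ∈ Ioo (0 : ℝ) 1) (hK : 0 < K)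
    (n₁ n₂ : ℕ → ℕ) (hn : ∀ n, n₁ n + n₂ n = n)
    (hn₁ : Tendsto (fun n => (n₁ n : ℝ) / n) atTop (𝓝 lam))
    -- the random inputs of the experiment with total budget `n`
    (X ε : ∀ n, Fin (n₁ n) → Ω → ℝ) (V η : ∀ n, Fin (n₂ n) → Ω → ℝ)
    (hexp : ∀ n, ChangePoint.IsTwoStageExperiment P ν (X n) (ε n) (V n) (η n))
    -- the first-stage least-squares estimator and its values `αn`, `βn`, `dn` on the data
    (αhat βhat dhat : ∀ m : ℕ, (Fin m → ℝ) → (Fin m → ℝ) → ℝ)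
    (hhat : ChangePoint.IsFirstStageEstimator αhat βhat dhat)
    (Y : ∀ n, Ω → Fin (n₁ n) → ℝ)
    (hY : ∀ n ω, Y n ω = ChangePoint.responses α₀ β₀ d₀ (fun i => X n i ω) (fun i => ε n i ω))
    (αn βn dn : ℕ → Ω → ℝ)
    (hαn : ∀ n ω, αn n ω = αhat (n₁ n) (fun i => X n i ω) (Y n ω))
    (hβn : ∀ n ω, βn n ω = βhat (n₁ n) (fun i => X n i ω) (Y n ω))
    (hdn : ∀ n ω, dn n ω = dhat (n₁ n) (fun i => X n i ω) (Y n ω))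
    -- the second-stage data, sampled uniformly from `[dn - K n₁ ^ (-γ), dn + K n₁ ^ (-γ)]`
    (U W : ∀ n, Ω → Fin (n₂ n) → ℝ)
    (hU : ∀ n ω, U n ω =
      ChangePoint.rescale (dn n ω) (ChangePoint.halfLength K γ (n₁ n)) (fun j => V n j ω))
    (hW : ∀ n ω, W n ω = ChangePoint.responses α₀ β₀ d₀ (U n ω) (fun j => η n j ω))
    -- the smallest and the largest second-stage minimizers
    (dl du : ℕ → Ω → ℝ)
    (hdl : ∀ n ω, IsLeast (ChangePoint.secondStageMinimizers (U n ω) (W n ω) (αn n ω) (βn n ω)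
      (dn n ω) (ChangePoint.halfLength K γ (n₁ n))) (dl n ω))
    (hdu : ∀ n ω, IsGreatest (ChangePoint.secondStageMinimizers (U n ω) (W n ω) (αn n ω) (βn n ω)
      (dn n ω) (ChangePoint.halfLength K γ (n₁ n))) (du n ω)) :
    ChangePoint.IsBoundedInProbability P
      (fun n ω => ((n : ℝ) ^ (1 + γ)) • (dl n ω - d₀, du n ω - d₀)) := by

  intro δ hδ
  have hδ2 : 0 < δ / 2 := by positivity
  have hΔ : β₀ - α₀ ≠ 0 := sub_ne_zero.2 hαβ.symm
  have hΔ' : 0 < |β₀ - α₀| := abs_pos.2 hΔ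
  set τ := (SignType.sign (β₀ - α₀) : ℝ) with hτ
  have hτ1 : |τ| = 1 := by
    rcases lt_or_gt_of_ne hΔ with h | h <;> simp [hτ, h]
  obtain ⟨J₁, hJ₁⟩ := ChangePoint.exists_first_stage_bound hmean hmgf hαβ hd₀ hδ2
  obtain ⟨J₂, hJ₂⟩ := ChangePoint.exists_exceptional_bound hmean hmgf
    (by positivity : 0 < 3 * |β₀ - α₀| / 8) hτ1 hδ2
  have hn₂ : Tendsto (fun n => (n₂ n : ℝ) / n) atTop (𝓝 (1 - lam)) := by
    refine (tendsto_const_nhds.sub hn₁).congr' ?_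
    filter_upwards [eventually_gt_atTop 0] with n h0
    have h0' : (n : ℝ) ≠ 0 := by positivity
    have : (n₁ n : ℝ) + n₂ n = n := by exact_mod_cast hn n
    field_simp
    linarith
  obtain ⟨t₁, r₁⟩ := ChangePoint.tendsto_atTop_of_ratio hlam.1 hn₁
  obtain ⟨t₂, r₂⟩ := ChangePoint.tendsto_atTop_of_ratio (sub_pos.2 hlam.2) hn₂
  obtain ⟨n₀, hn₀⟩ := eventually_atTop.1 ((((t₁.eventually hJ₁).and (t₁.eventually
    (ChangePoint.eventually_div_le_halfLength hK hγ.2 J₁))).and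
    ((t₁.eventually_gt_atTop 0).and (t₂.eventually_gt_atTop 0))).and
    ((r₁.and r₂).and (eventually_gt_atTop 0)))
  set A₀ := 2 * K * J₂ * (lam / 2) ^ (-γ) / ((1 - lam) / 2) with hA₀
  -- Deterministic bound for the finitely many small `n`: both `d₀` and the window's centre lie in
  -- `[0, 1]`.
  set b : ℕ → ℝ := fun n => (n : ℝ) ^ (1 + γ) * (1 + ChangePoint.halfLength K γ (n₁ n)) with hb
  have hh0 : ∀ n, 0 ≤ ChangePoint.halfLength K γ (n₁ n) := fun n => by
    rw [ChangePoint.halfLength]; positivity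
  have hb0 : ∀ n, 0 ≤ b n := fun n => mul_nonneg (by positivity) (by linarith [hh0 n])
  have hnorm : ∀ n ω B, |dl n ω - d₀| ≤ B → |du n ω - d₀| ≤ B →
      ‖((n : ℝ) ^ (1 + γ)) • (dl n ω - d₀, du n ω - d₀)‖ ≤ (n : ℝ) ^ (1 + γ) * B := by
    intro n ω B h1 h2
    rw [norm_smul, Real.norm_eq_abs, abs_of_nonneg (by positivity : 0 ≤ (n : ℝ) ^ (1 + γ)),
      Prod.norm_def]
    exact mul_le_mul_of_nonneg_left (max_le h1 h2) (by positivity)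
  have hmin : ∀ n ω, ChangePoint.IsLSMinimizer (fun i => X n i ω) (Y n ω) (αn n ω) (βn n ω)
      (dn n ω) := fun n ω => by
    rw [hαn, hβn, hdn]; exact (hhat.estimate _ _ _).1
  refine ⟨max A₀ (∑ k ∈ Finset.range n₀, b k), fun n => ?_⟩
  rcases lt_or_ge n n₀ with hlt | hge
  · have hempty : {ω | max A₀ (∑ k ∈ Finset.range n₀, b k) <
        ‖((n : ℝ) ^ (1 + γ)) • (dl n ω - d₀, du n ω - d₀)‖} = ∅ := by
      refine eq_empty_of_forall_notMem fun ω hω => not_lt.2 ?_ (mem_ofPred.1 hω)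
      have hdn01 := (hmin n ω).1
      have hbd : ∀ d ∈ ChangePoint.secondStageMinimizers (U n ω) (W n ω) (αn n ω) (βn n ω)
          (dn n ω) (ChangePoint.halfLength K γ (n₁ n)), |d - d₀| ≤
            1 + ChangePoint.halfLength K γ (n₁ n) := by
        intro d hd
        have h1 := hd.1
        exact abs_le.2 ⟨by linarith [h1.1, hdn01.1, hd₀.2], by linarith [h1.2, hdn01.2, hd₀.1]⟩
      refine (hnorm n ω _ (hbd _ (hdl n ω).1) (hbd _ (hdu n ω).1)).trans ?_
      exact (Finset.single_le_sum (f := b) (fun k _ => hb0 k) (Finset.mem_range.2 hlt)).trans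
        (le_max_right _ _)
    rw [hempty]
    simp
  · obtain ⟨⟨⟨⟨N, hN, hNgood⟩, hhalf⟩, hn₁0, hn₂0⟩, ⟨hr₁, hr₂⟩, hn0⟩ := hn₀ n hge
    set h := ChangePoint.halfLength K γ (n₁ n) with hh
    have hhpos : 0 < h := by rw [hh, ChangePoint.halfLength]; positivity
    -- The position of `d₀` after mapping the window to `[0, 1]`, as a function of the first sample
    -- alone.
    set Q : (Fin (n₁ n) → ℝ) × (Fin (n₁ n) → ℝ) → ℝ := fun p =>
      (d₀ - dhat (n₁ n) p.1 (ChangePoint.responses α₀ β₀ d₀ p.1 p.2) + h) / (2 * h) with hQ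
    have hQm : Measurable Q := by
      have h1 := (hhat.measurable_d (n₁ n)).comp (measurable_fst.prodMk
        (ChangePoint.measurable_responses (m := n₁ n) α₀ β₀ d₀))
      exact ((measurable_const.sub h1).add_const h).div_const (2 * h)
    have p₁ := ((hexp n).measure_first_stage_le N).trans hN
    have p₂ := (hexp n).measure_exceptional_le hQm (hJ₂ (n₂ n) hn₂0)
    rw [← add_halves δ, ENNReal.ofReal_add hδ2.le hδ2.le]
    refine (measure_mono fun ω hω => ?_).trans ((measure_union_le _ _).trans (add_le_add p₁ p₂))
    by_contra hgood
    simp only [mem_union, mem_ofPred_eq, not_or] at hgood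
    refine not_lt.2 ?_ (mem_ofPred.1 hω)
    have hm := hmin n ω
    rw [hY] at hm
    obtain ⟨gα, gβ, gd⟩ := hNgood _ _ hgood.1 _ _ _ hm
    have hbd : ∀ d ∈ ChangePoint.secondStageMinimizers (U n ω) (W n ω) (αn n ω) (βn n ω)
        (dn n ω) h, |d - d₀| ≤ 2 * h * (J₂ / n₂ n) := by
      intro d hd
      rw [hW, hU] at hd
      refine ChangePoint.abs_sub_le_of_mem_secondStageMinimizers hn₂0 hhpos hτ hαβ gα gβ
        (gd.trans hhalf) ?_ hd
      rw [hdn, hY]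
      exact hgood.2
    refine (hnorm n ω _ (hbd _ (hdl n ω).1) (hbd _ (hdu n ω).1)).trans ?_
    refine le_trans ?_ (le_max_left _ _)
    exact ChangePoint.rescaled_halfLength_le hK hγ.1 (half_pos hlam.1)
      (half_pos (sub_pos.2 hlam.2)) (by positivity) (by positivity) hr₁ hr₂
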